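/- Work in the theory AS (approximations of sets). For hereditarily finite sets put $F(0,A)=\{\}$ and $F(n+1,A)=\{F(n,x)\mid x\in A\}$. A *set* of AS is an arbitrary sequence $A=(A_n)_{n\ge 0}$, where $A_n$ is a hereditarily finite set of rank at most $n$ and $F(n,A_{n+1})=A_n$ for all $n$; we write $F(n,A)=A_n$, and $x\in A$ means that $F(n,x)\in F(n+1,A)$ for every $n$. For every property $\mathbf P$ of sets there is a smallest set that contains all $x$ with $\mathbf P(x)$; its $(n+1)$th approximation is $\{F(n,x)\mid \mathbf P(x)\}$. Subsets, unions, power sets $\mathcal P(A)$, ordered pairs $(a,b)=\{\{a\},\{a,b\}\}$, cartesian products and functions (as sets of ordered pairs) are defined as usual, with all objects being sets of AS. Let $0=\emptyset$, $1=\{0\}$, $2=\{0,1\}$, and let $\omega$ be the smallest set that contains all finite von Neumann ordinals. Write $A\le_c B$ if there is an injection from $A$ into $B$, $A=_cB$ if $A\le_cB$ and $B\le_cA$, and $A<_cB$ if $A\le_cB$ but not $A=_cB$. A set is *infinite* if it is in bijection with a proper subset of itself, and *countable* if it is not infinite or is in bijection with $\omega$. A set $R\subseteq A\times A$ *well-orders*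 $A$ if it linearly orders $A$ (it is transitive, and exactly one of $xRy$, $yRx$ holds for distinct $x,y\in A$; pairs $(x,x)$ are disregarded), every nonempty subset of $A$ has an $R$-minimal element (one that precedes all its other elements), and every $x\in A$ is *upward isolated*: for some $n$ there is no $y\in A$, $y\ne x$, with $F(n,y)=F(n,x)$ and $xRy$. A *cardinal* is either a set $\kappa$ with a relation $R$ that well-orders it such that $\kappa=_cS$ for no proper initial segment $S$ of $\kappa$, or a set which cannot be well-ordered. The *sum* of an indexed system of sets, that is, of a function $j\mapsto A_j$ (a set of AS) on a set $J$, is $\sum_{j\in J}A_j=\bigcup_{j\in J}\{j\}\times A_j$. A cardinal $\kappa$ is *regular* if $\sum_{j\in J}A_j<_c\kappa$ for every indexed system of cardinals $A_j<_c\kappa$ on an index set $J<_c\kappa$; otherwise it is *singular*. A nonempty cardinal $\kappa$ is a *limit* cardinal if it has no predecessor, i.e. there is no cardinal $\kappa'<_c\kappa$ such that no cardinal $\kappa''$ satisfies $\kappa'<_c\kappa''<_c\kappa$. An infinite cardinal $\kappa$ is a *strong limit* cardinal if $\mathcal P(\kappa')<_c\kappa$ for every cardinal $\kappa'<_c\kappa$.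 A cardinal is *inaccessible* if it is regular, limit and not countable, and *strongly inaccessible* if it is strong limit, regular and not countable. **Theorem.** The sets $0,1,2,\omega,\mathcal P(\omega)$ are cardinals (the well-orderable ones with a suitable well-ordering), and: 1. A cardinal $\kappa$ is regular if and only if $\kappa=_c0$, $\kappa=_c1$, $\kappa=_c2$, $\kappa=_c\omega$ or $\kappa=_c\mathcal P(\omega)$; all other cardinals are singular. 2. A cardinal $\kappa$ is a strong limit cardinal if and only if $\kappa=_c\omega$. 3. A cardinal $\kappa$ is inaccessible if and only if $\kappa=_c\mathcal P(\omega)$. 4. Strongly inaccessible cardinals do not exist. -/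

import Mathlib

namespace AS

/-! ### Hereditarily finite sets, approximations, sets and membership -/

/-- `HF n` is the type of hereditarily finite sets of rank at most `n`: the only one of rank `0` is
the empty set, and those of rank at most `n + 1` are the sets of hereditarily finite sets of rank
at most `n` (`HF n` is a finite type, so each of its subsets is finite). -/
def HF : ℕ → Type
  | 0 => Unit
  | n + 1 => Set (HF n)

/-- The set of the elements of a hereditarily finite set of rank at most `n + 1`. -/
def HF.elems {n : ℕ} (A : HF (n + 1)) : Set (HF n) := A

/-- The hereditarily finite set of rank at most `n + 1` with the given elements. -/
def HF.ofElems {n : ℕ} (S : Set (HF n)) : HF (n + 1) := S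

/-- The `n`-th approximation `F(n, A)` of a hereditarily finite set `A` of rank at most `n + 1`:
`F(0, A) = {}` and `F(n + 1, A) = {F(n, a) | a ∈ A}`. -/
def trunc : (n : ℕ) → HF (n + 1) → HF n
  | 0, _ => ()
  | n + 1, A => HF.ofElems (trunc n '' A.elems)

/-- The universe of all sets of the theory. A set is the same thing as an infinite path
`F(0, A), F(1, A), F(2, A), …` in the universal tree: the `n`-th node is a hereditarily finite set
of rank at most `n`, and it is the `n`-th approximation of the next node. -/
@[ext]
structure ASet where
  /-- `A.approx n` is `F(n, A)`. -/
  approx : (n : ℕ) → HF n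
  coherent : ∀ n, trunc n (approx (n + 1)) = approx n

/-- `x ∈ A` means that `F(n, x) ∈ F(n + 1, A)` for every `n`. -/
def ASet.Mem (A x : ASet) : Prop :=
  ∀ n, x.approx n ∈ (A.approx (n + 1)).elems

instance : Membership ASet ASet := ⟨ASet.Mem⟩

instance : HasSubset ASet := ⟨fun A B => ∀ x : ASet, x ∈ A → x ∈ B⟩

/-- The approximations of the smallest set that contains every `x` with `P x`:
`F(n + 1, ·) = {F(n, x) | P x}`. -/
def hullApprox (P : ASet → Prop) : (n : ℕ) → HF n
  | 0 => ()
  | n + 1 => HF.ofElems {h | ∃ x : ASet, P x ∧ x.approx n = h}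

theorem hullApprox_coherent (P : ASet → Prop) (n : ℕ) :
    trunc n (hullApprox P (n + 1)) = hullApprox P n := by
  cases n with
  | zero => rfl
  | succ n =>
    apply Set.ext
    intro h
    constructor
    · rintro ⟨_, ⟨x, hx, rfl⟩, rfl⟩
      exact ⟨x, hx, (x.coherent n).symm⟩
    · rintro ⟨x, hx, rfl⟩
      exact ⟨x.approx (n + 1), ⟨x, hx, rfl⟩, x.coherent n⟩

/-- The smallest set that contains every `x` with `P x`. Its elements are exactly the `x` with
`P x` whenever a set with exactly these elements exists. -/
def hull (P : ASet → Prop) : ASet := ⟨hullApprox P, hullApprox_coherent P⟩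

/-! ### Basic set constructions -/

/-- The empty set. -/
def empty : ASet := hull fun _ => False

/-- `{a}` -/
def single (a : ASet) : ASet := hull fun x => x = a

/-- `{a, b}` -/
def pair (a b : ASet) : ASet := hull fun x => x = a ∨ x = b

/-- The ordered pair `(a, b) = {{a}, {a, b}}`. -/
def opair (a b : ASet) : ASet := pair (single a) (pair a b)

/-- `A ∪ B` -/
def union (A B : ASet) : ASet := hull fun x => x ∈ A ∨ x ∈ B

/-- The union of a family of sets. -/
def sUnion (𝓕 : ASet) : ASet := hull fun x => ∃ A, A ∈ 𝓕 ∧ x ∈ A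

/-- The power set of `A`. -/
def powerset (A : ASet) : ASet := hull fun x => x ⊆ A

/-- The cartesian product `A × B`. -/
def prod (A B : ASet) : ASet := hull fun x => ∃ a b, a ∈ A ∧ b ∈ B ∧ x = opair a b

/-- The finite von Neumann ordinals `0 = ∅`, `n + 1 = n ∪ {n}`. -/
def nOrd : ℕ → ASet
  | 0 => empty
  | n + 1 => union (nOrd n) (single (nOrd n))

/-- `ω`, the smallest set that contains all finite von Neumann ordinals. -/
def omega : ASet := hull fun x => ∃ n : ℕ, x = nOrd n

/-! ### Functions and cardinality -/

/-- `f` is a function from `A` to `B`: a total functional relation between the elements of `A`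
and those of `B`. -/
def IsFunction (f A B : ASet) : Prop :=
  f ⊆ prod A B ∧
  (∀ a ∈ A, ∃ b ∈ B, opair a b ∈ f) ∧
  (∀ a b b', opair a b ∈ f → opair a b' ∈ f → b = b')

/-- `f` is an injection from `A` into `B`. -/
def IsInjection (f A B : ASet) : Prop :=
  IsFunction f A B ∧ ∀ a a' b, opair a b ∈ f → opair a' b ∈ f → a = a'

/-- `f` is a bijection from `A` to `B`. -/
def IsBijection (f A B : ASet) : Prop :=
  IsInjection f A B ∧ ∀ b ∈ B, ∃ a ∈ A, opair a b ∈ f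

/-- `A` is in bijection with `B`. -/
def InBijection (A B : ASet) : Prop := ∃ f, IsBijection f A B

/-- `A ≤_c B`: `A` is not of greater cardinality than `B`. -/
def LeC (A B : ASet) : Prop := ∃ f, IsInjection f A B

/-- `A =_c B`: `A` is of the same cardinality as `B`. -/
def EqC (A B : ASet) : Prop := LeC A B ∧ LeC B A

/-- `A <_c B`: `A` is of smaller cardinality than `B`. -/
def LtC (A B : ASet) : Prop := LeC A B ∧ ¬ EqC A B

/-- A set is infinite if it is in bijection with a proper subset of itself. -/
def IsInfinite (A : ASet) : Prop := ∃ B, B ⊆ A ∧ B ≠ A ∧ InBijection A B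

/-- A set is countable if it is finite or in bijection with `ω`. -/
def IsCountable (A : ASet) : Prop := ¬ IsInfinite A ∨ InBijection A omega

/-! ### Well-orderings -/

/-- `R` is a linear ordering of `A`. The pairs `(x, x)` carry no information: asymmetry and
totality are conditions on distinct elements. (As a set, `R` is closed in the topology of
approximations, so it contains `(x, x)` for every accumulation point `x` of `A`.) -/
def LinearlyOrders (R A : ASet) : Prop :=
  R ⊆ prod A A ∧
  (∀ x ∈ A, ∀ y ∈ A, x ≠ y → opair x y ∈ R → opair y x ∉ R) ∧
  (∀ x ∈ A, ∀ y ∈ A, ∀ z ∈ A, opair x y ∈ R → opair y z ∈ R → opair x z ∈ R) ∧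
  (∀ x ∈ A, ∀ y ∈ A, x ≠ y → opair x y ∈ R ∨ opair y x ∈ R)

/-- `x` is upward isolated in `A` with regard to `R`: some neighborhood
`{y | F(n, y) = F(n, x)}` of `x` contains no `y ∈ A` that lies above `x`. -/
def UpwardIsolated (R A x : ASet) : Prop :=
  ∃ n : ℕ, ∀ y ∈ A, y ≠ x → y.approx n = x.approx n → opair x y ∉ R

/-- `R` well-orders `A`. -/
def WellOrders (R A : ASet) : Prop :=
  LinearlyOrders R A ∧
  (∀ B, B ⊆ A → B ≠ empty → ∃ m ∈ B, ∀ x ∈ B, x ≠ m → opair m x ∈ R) ∧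
  (∀ x ∈ A, UpwardIsolated R A x)

/-- `A` can be well-ordered. -/
def WellOrderable (A : ASet) : Prop := ∃ R, WellOrders R A

/-- `S` is a proper initial segment of `A` with regard to the ordering `R`. -/
def IsProperInitialSegment (R A S : ASet) : Prop :=
  S ⊆ A ∧ S ≠ A ∧ ∀ x ∈ S, ∀ y ∈ A, opair y x ∈ R → y ∈ S

/-! ### Cardinals -/

/-- The ordinal `(A, R)` is a cardinal: `R` well-orders `A`, and `A` is not of the same cardinality
as any of its proper initial segments. -/
def IsWellOrderedCardinal (A R : ASet) : Prop :=
  WellOrders R A ∧ ∀ S, IsProperInitialSegment R A S → ¬ EqC A S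

/-- `A` is (the underlying set of) a cardinal: an ordinal `(A, R)` which is a cardinal, or a set
which cannot be well-ordered. -/
def IsCardinal (A : ASet) : Prop :=
  (∃ R, IsWellOrderedCardinal A R) ∨ ¬ WellOrderable A

/-- `I` is an indexed system of sets with set of indexes `J`, that is, a function from `J` to some
family of sets. -/
def IsIndexedSystem (I J : ASet) : Prop := ∃ 𝓕, IsFunction I J 𝓕

/-- The sum of an indexed system of sets: the union of the family of all `{j} × A_j`, where
`(j, A_j) ∈ I`. -/
def sum (I : ASet) : ASet :=
  sUnion (hull fun x => ∃ j A, opair j A ∈ I ∧ x = prod (single j) A)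

/-- `κ` is a regular cardinal: it is of greater cardinality than any sum of less than `κ` cardinals
of smaller cardinality than `κ`. -/
def IsRegular (κ : ASet) : Prop :=
  IsCardinal κ ∧
  ∀ I J, IsIndexedSystem I J → LtC J κ →
    (∀ j A, opair j A ∈ I → IsCardinal A ∧ LtC A κ) → LtC (sum I) κ

/-- `κ` is a singular cardinal. -/
def IsSingular (κ : ASet) : Prop := IsCardinal κ ∧ ¬ IsRegular κ

/-- The cardinal `κ` is a predecessor of the cardinal `κ'`. -/
def IsPredecessor (κ κ' : ASet) : Prop :=
  IsCardinal κ ∧ IsCardinal κ' ∧ LtC κ κ' ∧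
    ¬ ∃ κ'', IsCardinal κ'' ∧ LtC κ κ'' ∧ LtC κ'' κ'

/-- `κ` is a limit cardinal: a nonempty cardinal without predecessor. -/
def IsLimit (κ : ASet) : Prop :=
  IsCardinal κ ∧ κ ≠ empty ∧ ¬ ∃ κ', IsPredecessor κ' κ

/-- `κ` is a strong limit cardinal. -/
def IsStrongLimit (κ : ASet) : Prop :=
  IsCardinal κ ∧ IsInfinite κ ∧
    ∀ κ', IsCardinal κ' → LtC κ' κ → LtC (powerset κ') κ

/-- `κ` is an inaccessible cardinal. -/
def IsInaccessible (κ : ASet) : Prop :=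
  IsRegular κ ∧ IsLimit κ ∧ ¬ IsCountable κ

/-- `κ` is a strongly inaccessible cardinal. -/
def IsStronglyInaccessible (κ : ASet) : Prop :=
  IsStrongLimit κ ∧ IsRegular κ ∧ ¬ IsCountable κ

end AS

namespace AS

open Set Topology

/-! ### The topology of approximations -/

/-! The universe is the space of infinite paths through a finitely branching tree, hence compact,
metrizable and zero-dimensional. Sets correspond exactly to its closed subsets. By compactness,
functions between sets are exactly continuous maps, so `A ≤_c B` says that `A` embeds topologically
in `B` (`leC_iff`).

By the perfect set theorem an uncountable closed set contains a Cantor set, into which the whole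
universe embeds. So all uncountable sets have the cardinality of `P(ω)`, and everything smaller is
countable (`leC_of_not_countable`). Well-orderable sets are countable, because upward isolation
codes their points injectively by nodes of the tree. The set `ω` contains itself as the limit of the
finite ordinals; it is a convergent sequence with its limit, and embeds in every infinite set.

Uncountable sets are regular because countable unions of countable sets are countable, `ω` because
finite unions of finite sets are finite, and sets with at most two points because all indices and
summands have at most one point. A larger finite set splits into a point and the rest. The hard case
is a countably infinite `κ` not equivalent to `ω` (`not_isRegular_of_countable`). Either some finite
partition into neighborhoods has all parts smaller than `κ`, or some point `p` has a copy of `κ` in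
each of its neighborhoods. In the second case `κ` is cut into shells around `p`, indexed by a set no
larger than `ω`. A shell containing a copy of `κ` would be disjoint from another copy near `p`, and
iterating two disjoint self-embeddings produces continuum many points
(`not_countable_of_two_copies`).

The same doubling lemma gives `A <_c 2 × A` for countable nonempty `A`, so `P(ω)` has no
predecessor. A strong limit above `ω` would have to exceed `P(ω)`, which is impossible. -/

instance HF.instFinite : (n : ℕ) → Finite (HF n)
  | 0 => inferInstanceAs (Finite Unit)
  | n + 1 => by
    have := HF.instFinite n
    exact inferInstanceAs (Finite (Set (HF n)))

instance (n : ℕ) : TopologicalSpace (HF n) := ⊥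

instance (n : ℕ) : DiscreteTopology (HF n) := ⟨rfl⟩

/-- The topology of approximations, in which the sets `{y | F(n, y) = F(n, x)}` form a basis. -/
instance : TopologicalSpace ASet := TopologicalSpace.induced ASet.approx inferInstance

theorem isClosedEmbedding_approx : IsClosedEmbedding ASet.approx where
  eq_induced := rfl
  injective _ _ h := ASet.ext h
  isClosed_range := by
    have : range ASet.approx = {f | ∀ n, trunc n (f (n + 1)) = f n} := by
      ext f
      exact ⟨by rintro ⟨x, rfl⟩; exact x.coherent, fun h => ⟨⟨f, h⟩, rfl⟩⟩
    rw [this, Set.ofPred_forall]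
    refine isClosed_iInter fun n => isClosed_eq ?_ (continuous_apply n)
    exact continuous_of_discreteTopology.comp (continuous_apply (n + 1))

instance : CompactSpace ASet := isClosedEmbedding_approx.compactSpace

instance : T2Space ASet := isClosedEmbedding_approx.isEmbedding.t2Space

instance : PolishSpace ASet := isClosedEmbedding_approx.polishSpace

theorem continuous_approx (n : ℕ) : Continuous fun x : ASet => x.approx n :=
  (continuous_apply n).comp isClosedEmbedding_approx.continuous

/-- The set of all `y` with `F(n, y) = F(n, x)`. -/
def ball (n : ℕ) (x : ASet) : Set ASet := {y | y.approx n = x.approx n}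

theorem mem_ball {n : ℕ} {x y : ASet} : y ∈ ball n x ↔ y.approx n = x.approx n := Iff.rfl

theorem mem_ball_self (n : ℕ) (x : ASet) : x ∈ ball n x := rfl

theorem isClopen_ball (n : ℕ) (x : ASet) : IsClopen (ball n x) :=
  (isClopen_discrete {x.approx n}).preimage (continuous_approx n)

theorem approx_eq_of_le {x y : ASet} {m n : ℕ} (hmn : m ≤ n) (h : x.approx n = y.approx n) :
    x.approx m = y.approx m := by
  induction n, hmn using Nat.le_induction with
  | base => exact h
  | succ n _ ih => exact ih (by rw [← x.coherent, h, y.coherent])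

theorem ball_anti {m n : ℕ} (hmn : m ≤ n) (x : ASet) : ball n x ⊆ ball m x :=
  fun _ hy => approx_eq_of_le hmn hy

theorem eq_of_forall_approx {x y : ASet} (h : ∀ n, x.approx n = y.approx n) : x = y :=
  ASet.ext (funext h)

theorem exists_approx_ne {x y : ASet} (h : x ≠ y) : ∃ n, x.approx n ≠ y.approx n := by
  by_contra! H
  exact h (eq_of_forall_approx H)

/-- Compactness: if every ball around `x` met the complement of an open `V ∋ x`, these nested closed
sets would share a point, which agrees with `x` at every level and so equals `x`. -/
theorem nhds_hasBasis (x : ASet) : (𝓝 x).HasBasis (fun _ : ℕ => True) (fun n => ball n x) := by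
  refine ⟨fun U => ⟨fun hU => ?_, fun ⟨n, _, hn⟩ =>
    Filter.mem_of_superset ((isClopen_ball n x).isOpen.mem_nhds rfl) hn⟩⟩
  obtain ⟨V, hVU, hV, hxV⟩ := mem_nhds_iff.1 hU
  by_contra! H
  have hne : ∀ n, (ball n x ∩ Vᶜ).Nonempty := fun n => by
    obtain ⟨y, hy, hyU⟩ := not_subset.1 (H n trivial)
    exact ⟨y, hy, fun h => hyU (hVU h)⟩
  have hcl : ∀ n, IsClosed (ball n x ∩ Vᶜ) := fun n =>
    (isClopen_ball n x).isClosed.inter hV.isClosed_compl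
  obtain ⟨y, hy⟩ := IsCompact.nonempty_iInter_of_sequence_nonempty_isCompact_isClosed _
    (fun n => inter_subset_inter_left _ (ball_anti n.le_succ x)) hne (hcl 0).isCompact hcl
  rw [mem_iInter] at hy
  exact (hy 0).2 (eq_of_forall_approx (fun n => (hy n).1) ▸ hxV)

theorem continuousOn_iff_approx {f : ASet → ASet} {S : Set ASet} :
    ContinuousOn f S ↔ ∀ x ∈ S, ∀ n, ∃ N, ∀ y ∈ S, y.approx N = x.approx N →
      (f y).approx n = (f x).approx n := by
  refine forall₂_congr fun x _ => ?_
  rw [ContinuousWithinAt, ((nhdsWithin_hasBasis (nhds_hasBasis x) S)).tendsto_iff (nhds_hasBasis _)]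
  simp only [true_and, forall_const]
  exact forall_congr' fun n => exists_congr fun N =>
    ⟨fun h y hy hyx => h y ⟨hyx, hy⟩, fun h y hy => h y hy.2 hy.1⟩

theorem isClosed_iff_approx {S : Set ASet} :
    IsClosed S ↔ ∀ x, (∀ n, ∃ y ∈ S, y.approx n = x.approx n) → x ∈ S := by
  rw [← closure_subset_iff_isClosed]
  refine forall_congr' fun x => imp_congr ?_ Iff.rfl
  rw [mem_closure_iff_nhds_basis (nhds_hasBasis x)]
  simp [mem_ball]

/-! ### Membership and hulls -/

/-- The elements of a set, as a set of points of the universe. -/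
def ASet.elts (A : ASet) : Set ASet := {x | x ∈ A}

@[simp] theorem mem_elts {A x : ASet} : x ∈ A.elts ↔ x ∈ A := Iff.rfl

theorem mem_def {A x : ASet} : x ∈ A ↔ ∀ n, x.approx n ∈ (A.approx (n + 1)).elems := Iff.rfl

/-- A set whose `n`th approximation is a given hereditarily finite set. -/
def HF.lift : (n : ℕ) → HF n → ASet
  | 0, _ => empty
  | n + 1, S => hull fun x => ∃ h ∈ S.elems, x = HF.lift n h

theorem HF.approx_lift : (n : ℕ) → (h : HF n) → (HF.lift n h).approx n = h
  | 0, _ => rfl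
  | n + 1, S => by
    refine Set.ext fun h => ⟨?_, fun hh => ⟨HF.lift n h, ⟨h, hh, rfl⟩, HF.approx_lift n h⟩⟩
    rintro ⟨_, ⟨h, hh, rfl⟩, rfl⟩
    rwa [HF.approx_lift n h]

theorem trunc_elems {n : ℕ} (A : HF (n + 2)) : (trunc (n + 1) A).elems = trunc n '' A.elems := rfl

theorem elems_approx_mono {A x : ASet} {m n : ℕ} (hmn : m ≤ n)
    (h : x.approx n ∈ (A.approx (n + 1)).elems) : x.approx m ∈ (A.approx (m + 1)).elems := by
  induction n, hmn using Nat.le_induction with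
  | base => exact h
  | succ n _ ih =>
    refine ih ?_
    rw [← A.coherent (n + 1), trunc_elems]
    exact ⟨_, h, x.coherent n⟩

/-- König's lemma: coherence extends a node of `A` to every higher level, and compactness turns
these finite extensions into an actual element. Hence the approximations of `A` carry no more
information than its elements. -/
theorem exists_mem_approx_eq {A : ASet} {n : ℕ} {h : HF n} (hh : h ∈ (A.approx (n + 1)).elems) :
    ∃ x ∈ A, x.approx n = h := by
  let D : ℕ → Set ASet := fun k =>
    {x | x.approx n = h} ∩ {x | x.approx (n + k) ∈ (A.approx (n + k + 1)).elems}
  have hne : ∀ k, (D k).Nonempty := by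
    intro k
    induction k with
    | zero => exact ⟨HF.lift n h, HF.approx_lift n h, by simpa [HF.approx_lift] using hh⟩
    | succ k ih =>
      obtain ⟨x, hx, hx'⟩ := ih
      simp only [mem_ofPred_eq] at hx'
      rw [← A.coherent (n + k + 1), trunc_elems] at hx'
      obtain ⟨g, hg, hgx⟩ := hx'
      have hl : (HF.lift (n + k + 1) g).approx (n + k) = x.approx (n + k) := by
        rw [← ASet.coherent, HF.approx_lift, hgx]
      exact ⟨HF.lift (n + k + 1) g, (approx_eq_of_le (Nat.le_add_right n k) hl).trans hx,
        show (HF.lift (n + k + 1) g).approx (n + k + 1) ∈ (A.approx (n + k + 1 + 1)).elems by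
          rwa [HF.approx_lift]⟩
  have hcl : ∀ k, IsClosed (D k) := fun k =>
    ((isClosed_discrete {h}).preimage (continuous_approx n)).inter
      ((isClosed_discrete _).preimage (continuous_approx (n + k)))
  obtain ⟨x, hx⟩ := IsCompact.nonempty_iInter_of_sequence_nonempty_isCompact_isClosed D
    (fun k x hx => ⟨hx.1, elems_approx_mono (Nat.le_succ _) hx.2⟩) hne (hcl 0).isCompact hcl
  rw [mem_iInter] at hx
  exact ⟨x, fun k => elems_approx_mono (Nat.le_add_left k n) (hx k).2, (hx 0).1⟩

theorem approx_succ_elems (A : ASet) (n : ℕ) :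
    (A.approx (n + 1)).elems = (fun x => x.approx n) '' A.elts :=
  Set.ext fun _ => ⟨fun hh => exists_mem_approx_eq hh, by rintro ⟨x, hx, rfl⟩; exact hx n⟩

theorem approx_succ_eq_iff {A B : ASet} {n : ℕ} :
    A.approx (n + 1) = B.approx (n + 1) ↔
      (∀ x ∈ A, ∃ y ∈ B, y.approx n = x.approx n) ∧ ∀ y ∈ B, ∃ x ∈ A, x.approx n = y.approx n := by
  change (A.approx (n + 1)).elems = (B.approx (n + 1)).elems ↔ _
  rw [approx_succ_elems, approx_succ_elems, Subset.antisymm_iff, image_subset_iff,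
    image_subset_iff]
  rfl

theorem ext_mem {A B : ASet} (h : ∀ x, x ∈ A ↔ x ∈ B) : A = B := by
  refine eq_of_forall_approx fun n => ?_
  cases n with
  | zero => rfl
  | succ n => exact approx_succ_eq_iff.2 ⟨fun x hx => ⟨x, (h x).1 hx, rfl⟩,
      fun x hx => ⟨x, (h x).2 hx, rfl⟩⟩

theorem elts_injective : Function.Injective ASet.elts := fun _ _ h => ext_mem (Set.ext_iff.1 h)

theorem isClosed_elts (A : ASet) : IsClosed A.elts := by
  have : A.elts = ⋂ n, (fun x : ASet => x.approx n) ⁻¹' (A.approx (n + 1)).elems := by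
    ext x
    simp [mem_def]
  rw [this]
  exact isClosed_iInter fun n => (isClosed_discrete _).preimage (continuous_approx n)

theorem mem_hull_iff {P : ASet → Prop} {x : ASet} :
    x ∈ hull P ↔ ∀ n, ∃ y, P y ∧ y.approx n = x.approx n := Iff.rfl

theorem mem_hull {P : ASet → Prop} (hP : IsClosed {x | P x}) {x : ASet} : x ∈ hull P ↔ P x :=
  mem_hull_iff.trans ⟨isClosed_iff_approx.1 hP x, fun h _ => ⟨x, h, rfl⟩⟩

theorem elts_hull {P : ASet → Prop} (hP : IsClosed {x | P x}) : (hull P).elts = {x | P x} :=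
  Set.ext fun _ => mem_hull hP

/-- The set whose elements are the points of a closed set. -/
def ofClosed (S : Set ASet) : ASet := hull (· ∈ S)

theorem mem_ofClosed {S : Set ASet} (hS : IsClosed S) {x : ASet} : x ∈ ofClosed S ↔ x ∈ S :=
  mem_hull hS

theorem elts_ofClosed {S : Set ASet} (hS : IsClosed S) : (ofClosed S).elts = S := elts_hull hS

theorem subset_iff_elts {A B : ASet} : A ⊆ B ↔ A.elts ⊆ B.elts := Iff.rfl

/-- Membership is a closed relation. -/
theorem isClosed_mem : IsClosed {p : ASet × ASet | p.1 ∈ p.2} := by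
  have : {p : ASet × ASet | p.1 ∈ p.2} =
      ⋂ n, (fun p : ASet × ASet => (p.1.approx n, p.2.approx (n + 1))) ⁻¹' {q | q.1 ∈ q.2.elems} := by
    ext p
    simp [mem_def]
  rw [this]
  exact isClosed_iInter fun n => (isClosed_discrete _).preimage
    (((continuous_approx n).comp continuous_fst).prodMk
      ((continuous_approx (n + 1)).comp continuous_snd))

/-! ### Elements of the basic constructions -/

theorem not_mem_empty (x : ASet) : x ∉ empty := fun h => by
  obtain ⟨y, hy, -⟩ := mem_hull_iff.1 h 0
  exact hy

@[simp] theorem elts_empty : empty.elts = ∅ := eq_empty_of_forall_notMem not_mem_empty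

theorem eq_empty_iff {A : ASet} : A = empty ↔ ∀ x, x ∉ A :=
  ⟨by rintro rfl; exact not_mem_empty, fun h => ext_mem fun x => by simp [h x, not_mem_empty]⟩

@[simp] theorem mem_single {a x : ASet} : x ∈ single a ↔ x = a :=
  mem_hull (isClosed_singleton (x := a))

@[simp] theorem mem_pair {a b x : ASet} : x ∈ pair a b ↔ x = a ∨ x = b :=
  mem_hull ((toFinite {a, b}).isClosed)

@[simp] theorem mem_union {A B x : ASet} : x ∈ union A B ↔ x ∈ A ∨ x ∈ B :=
  mem_hull ((isClosed_elts A).union (isClosed_elts B))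

theorem opair_inj {a b c d : ASet} : opair a b = opair c d ↔ a = c ∧ b = d := by
  refine ⟨fun h => ?_, by rintro ⟨rfl, rfl⟩; rfl⟩
  have hs : ∀ {u v : ASet}, single u = single v → u = v := fun {u v} h =>
    mem_single.1 (h ▸ mem_single.2 rfl : u ∈ single v)
  have hp : ∀ {u v w : ASet}, pair u v = single w → u = w ∧ v = w := fun {u v w} h =>
    ⟨mem_single.1 (h ▸ mem_pair.2 (.inl rfl)), mem_single.1 (h ▸ mem_pair.2 (.inr rfl))⟩
  have h1 : single a ∈ opair c d := h ▸ mem_pair.2 (.inl rfl)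
  have h2 : pair a b ∈ opair c d := h ▸ mem_pair.2 (.inr rfl)
  have h3 : pair c d ∈ opair a b := h ▸ mem_pair.2 (.inr rfl)
  have hac : a = c := by
    rcases mem_pair.1 h1 with h | h
    · exact hs h
    · exact (hp h.symm).1.symm
  subst hac
  refine ⟨rfl, ?_⟩
  rcases mem_pair.1 h2 with h2 | h2
  · obtain ⟨-, rfl⟩ := hp h2
    rcases mem_pair.1 h3 with h3 | h3
    · exact (hp h3).2.symm
    · exact ((mem_pair.1 (h3 ▸ mem_pair.2 (.inr rfl) : d ∈ pair b b)).elim id id).symm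
  · have hb : b ∈ pair a d := h2 ▸ mem_pair.2 (.inr rfl)
    have hd : d ∈ pair a b := h2 ▸ mem_pair.2 (.inr rfl)
    rcases mem_pair.1 hb with rfl | hb
    · exact ((mem_pair.1 hd).elim id id).symm
    · exact hb

theorem approx_single {a c : ASet} {n : ℕ} (h : a.approx n = c.approx n) :
    (single a).approx (n + 1) = (single c).approx (n + 1) := by
  simp [approx_succ_eq_iff, h]

theorem approx_pair {a b c d : ASet} {n : ℕ} (h : a.approx n = c.approx n)
    (h' : b.approx n = d.approx n) : (pair a b).approx (n + 1) = (pair c d).approx (n + 1) := by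
  simp [approx_succ_eq_iff, h, h']

theorem approx_opair {a b c d : ASet} {n : ℕ} (h : a.approx n = c.approx n)
    (h' : b.approx n = d.approx n) : (opair a b).approx n = (opair c d).approx n :=
  approx_eq_of_le (n.le_add_right 2)
    (approx_pair (approx_single h) (approx_pair h h'))

theorem continuous_opair : Continuous fun p : ASet × ASet => opair p.1 p.2 := by
  rw [continuous_iff_continuousAt]
  rintro ⟨a, b⟩
  rw [ContinuousAt, nhds_prod_eq,
    ((nhds_hasBasis a).prod (nhds_hasBasis b)).tendsto_iff (nhds_hasBasis _)]
  exact fun n _ => ⟨(n, n), ⟨trivial, trivial⟩, fun p hp => approx_opair hp.1 hp.2⟩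

theorem mem_powerset {A x : ASet} : x ∈ powerset A ↔ x ⊆ A := by
  refine mem_hull (P := (· ⊆ A)) (isClosed_iff_approx.2 fun x hx => ?_)
  intro y hy
  refine isClosed_iff_approx.1 (isClosed_elts A) y fun n => ?_
  obtain ⟨z, hz, hzx⟩ := hx (n + 1)
  obtain ⟨w, hw, hwy⟩ := (approx_succ_eq_iff.1 hzx).2 y hy
  exact ⟨w, hz w hw, hwy⟩

theorem mem_prod {A B x : ASet} : x ∈ prod A B ↔ ∃ a b, a ∈ A ∧ b ∈ B ∧ x = opair a b := by
  refine mem_hull ?_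
  have : {x | ∃ a b, a ∈ A ∧ b ∈ B ∧ x = opair a b} =
      (fun p : ASet × ASet => opair p.1 p.2) '' (A.elts ×ˢ B.elts) := by
    ext x
    constructor
    · rintro ⟨a, b, ha, hb, rfl⟩
      exact ⟨(a, b), ⟨ha, hb⟩, rfl⟩
    · rintro ⟨⟨a, b⟩, ⟨ha, hb⟩, rfl⟩
      exact ⟨a, b, ha, hb, rfl⟩
  rw [this]
  exact (((isClosed_elts A).prod (isClosed_elts B)).isCompact.image continuous_opair).isClosed

@[simp] theorem opair_mem_prod {A B a b : ASet} : opair a b ∈ prod A B ↔ a ∈ A ∧ b ∈ B := by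
  rw [mem_prod]
  refine ⟨?_, fun ⟨ha, hb⟩ => ⟨a, b, ha, hb, rfl⟩⟩
  rintro ⟨c, d, hc, hd, h⟩
  obtain ⟨rfl, rfl⟩ := opair_inj.1 h
  exact ⟨hc, hd⟩

/-- A closed family of closed sets has closed union, as a projection of a compact part of the
membership relation; so the hull adds nothing. -/
theorem mem_sUnion {𝓕 x : ASet} : x ∈ sUnion 𝓕 ↔ ∃ A, A ∈ 𝓕 ∧ x ∈ A := by
  refine mem_hull ?_
  have : {x | ∃ A, A ∈ 𝓕 ∧ x ∈ A} =
      Prod.fst '' ({p : ASet × ASet | p.1 ∈ p.2} ∩ Prod.snd ⁻¹' 𝓕.elts) := by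
    ext x
    simp [and_comm]
  rw [this]
  exact ((isClosed_mem.inter ((isClosed_elts 𝓕).preimage continuous_snd)).isCompact.image
    continuous_fst).isClosed

theorem isClosed_opair_mem (f : ASet) : IsClosed {p : ASet × ASet | opair p.1 p.2 ∈ f} :=
  (isClosed_elts f).preimage continuous_opair

/-! ### Injections are continuous injective maps -/

/-- Closed graph theorem for compact spaces: the preimage of a closed set is the projection of a
compact part of the graph. -/
theorem continuousOn_of_isFunction {f A B : ASet} (hf : IsFunction f A B) {g : ASet → ASet}
    (hg : ∀ a ∈ A, opair a (g a) ∈ f) : ContinuousOn g A.elts := by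
  refine continuousOn_iff_isClosed.2 fun t ht =>
    ⟨Prod.fst '' ({p : ASet × ASet | opair p.1 p.2 ∈ f} ∩ Prod.snd ⁻¹' t), ?_, ?_⟩
  · exact (((isClosed_opair_mem f).inter (ht.preimage continuous_snd)).isCompact.image
      continuous_fst).isClosed
  · ext a
    constructor
    · rintro ⟨hat, ha⟩
      exact ⟨⟨(a, g a), ⟨hg a ha, hat⟩, rfl⟩, ha⟩
    · rintro ⟨⟨⟨_, b⟩, ⟨hab, hb⟩, rfl⟩, ha⟩
      refine ⟨?_, ha⟩
      simpa [hf.2.2 _ _ _ (hg _ ha) hab] using hb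

/-- The graph of a map, restricted to `A`, as a set. -/
def graph (g : ASet → ASet) (A : ASet) : ASet := ofClosed ((fun x => opair x (g x)) '' A.elts)

theorem opair_mem_graph {g : ASet → ASet} {A : ASet} (hg : ContinuousOn g A.elts) {a b : ASet} :
    opair a b ∈ graph g A ↔ a ∈ A ∧ b = g a := by
  rw [graph, mem_ofClosed]
  · constructor
    · rintro ⟨c, hc, h⟩
      obtain ⟨rfl, rfl⟩ := opair_inj.1 h
      exact ⟨hc, rfl⟩
    · rintro ⟨ha, rfl⟩
      exact ⟨a, ha, rfl⟩
  · exact ((isClosed_elts A).isCompact.image_of_continuousOn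
      (continuous_opair.comp_continuousOn (continuousOn_id.prodMk hg))).isClosed

theorem isFunction_graph {g : ASet → ASet} {A B : ASet} (hg : ContinuousOn g A.elts)
    (hB : MapsTo g A.elts B.elts) : IsFunction (graph g A) A B := by
  refine ⟨fun x hx => ?_, fun a ha => ⟨g a, hB ha, (opair_mem_graph hg).2 ⟨ha, rfl⟩⟩, ?_⟩
  · have hcl : IsClosed ((fun x => opair x (g x)) '' A.elts) :=
      ((isClosed_elts A).isCompact.image_of_continuousOn
        (continuous_opair.comp_continuousOn (continuousOn_id.prodMk hg))).isClosed
    obtain ⟨a, ha, rfl⟩ := (mem_ofClosed hcl).1 hx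
    exact opair_mem_prod.2 ⟨ha, hB ha⟩
  · intro a b b' h h'
    rw [((opair_mem_graph hg).1 h).2, ((opair_mem_graph hg).1 h').2]

theorem leC_iff {A B : ASet} : LeC A B ↔
    ∃ g : ASet → ASet, ContinuousOn g A.elts ∧ InjOn g A.elts ∧ MapsTo g A.elts B.elts := by
  classical
  constructor
  · rintro ⟨f, hf, hinj⟩
    choose! g hgB hg using hf.2.1
    exact ⟨g, continuousOn_of_isFunction hf hg,
      fun a ha b hb hab => hinj a b (g b) (hab ▸ hg a ha) (hg b hb), hgB⟩
  · rintro ⟨g, hg, hinj, hB⟩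
    refine ⟨graph g A, isFunction_graph hg hB, fun a a' b h h' => ?_⟩
    rw [opair_mem_graph hg] at h h'
    exact hinj h.1 h'.1 (h.2.symm.trans h'.2)

theorem inBijection_of_continuousOn {A B : ASet} {g : ASet → ASet} (hg : ContinuousOn g A.elts)
    (hinj : InjOn g A.elts) (hB : g '' A.elts = B.elts) : InBijection A B := by
  refine ⟨graph g A, ⟨isFunction_graph hg (hB ▸ mapsTo_image g A.elts), fun a a' b h h' => ?_⟩, ?_⟩
  · rw [opair_mem_graph hg] at h h'
    exact hinj h.1 h'.1 (h.2.symm.trans h'.2)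
  · intro b hb
    obtain ⟨a, ha, rfl⟩ : b ∈ g '' A.elts := hB ▸ hb
    exact ⟨a, ha, (opair_mem_graph hg).2 ⟨ha, rfl⟩⟩

theorem exists_of_inBijection {A B : ASet} (h : InBijection A B) :
    ∃ g : ASet → ASet, ContinuousOn g A.elts ∧ InjOn g A.elts ∧ g '' A.elts = B.elts := by
  classical
  obtain ⟨f, ⟨hf, hinj⟩, hsurj⟩ := h
  choose! g hgB hg using hf.2.1
  refine ⟨g, continuousOn_of_isFunction hf hg,
      fun a ha b hb hab => hinj a b (g b) (hab ▸ hg a ha) (hg b hb), ?_⟩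
  refine Subset.antisymm (image_subset_iff.2 hgB) fun b hb => ?_
  obtain ⟨a, ha, hab⟩ := hsurj b hb
  exact ⟨a, ha, hf.2.2 _ _ _ (hg a ha) hab⟩

theorem LeC.of_subset {A B : ASet} (h : A ⊆ B) : LeC A B :=
  leC_iff.2 ⟨id, continuousOn_id, injOn_id _, h⟩

theorem LeC.refl (A : ASet) : LeC A A := .of_subset fun _ h => h

theorem LeC.trans {A B C : ASet} (h : LeC A B) (h' : LeC B C) : LeC A C := by
  obtain ⟨f, hf, hfi, hfm⟩ := leC_iff.1 h
  obtain ⟨g, hg, hgi, hgm⟩ := leC_iff.1 h'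
  exact leC_iff.2 ⟨g ∘ f, hg.comp hf hfm, hgi.comp hfi hfm, hgm.comp hfm⟩

theorem ltC_iff {A B : ASet} : LtC A B ↔ LeC A B ∧ ¬ LeC B A :=
  ⟨fun h => ⟨h.1, fun h' => h.2 ⟨h.1, h'⟩⟩, fun h => ⟨h.1, fun h' => h.2 h'.2⟩⟩

theorem LtC.of_leC {A B C : ASet} (h : LtC A B) (h' : LeC B C) : LtC A C :=
  ltC_iff.2 ⟨h.1.trans h', fun H => (ltC_iff.1 h).2 (h'.trans H)⟩

/-! ### Finite, countable and uncountable sets -/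

theorem LeC.countable {A B : ASet} (h : LeC A B) (hB : B.elts.Countable) : A.elts.Countable := by
  obtain ⟨f, -, hfi, hfm⟩ := leC_iff.1 h
  exact hfm.countable_of_injOn hfi hB

theorem LeC.encard_le {A B : ASet} (h : LeC A B) : A.elts.encard ≤ B.elts.encard := by
  obtain ⟨f, -, hfi, hfm⟩ := leC_iff.1 h
  exact encard_le_encard_of_injOn hfm hfi

theorem LeC.finite {A B : ASet} (h : LeC A B) (hB : B.elts.Finite) : A.elts.Finite :=
  encard_lt_top_iff.1 (h.encard_le.trans_lt hB.encard_lt_top)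

theorem continuousOn_of_finite {S : Set ASet} (hS : S.Finite) (f : ASet → ASet) :
    ContinuousOn f S :=
  continuousOn_iff_isClosed.2 fun t _ => ⟨f ⁻¹' t ∩ S, (hS.inter_of_right _).isClosed, by simp⟩

theorem leC_of_encard_le {A B : ASet} (hA : A.elts.Finite) (h : A.elts.encard ≤ B.elts.encard) :
    LeC A B := by
  have : Nonempty ASet := ⟨empty⟩
  obtain ⟨f, hf, hfi⟩ := hA.exists_injOn_of_encard_le h
  exact leC_iff.2 ⟨f, continuousOn_of_finite hA f, hfi, hf⟩

theorem ltC_of_encard_lt {A B : ASet} (h : A.elts.encard < B.elts.encard) : LtC A B :=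
  ltC_iff.2 ⟨leC_of_encard_le (encard_lt_top_iff.1 (h.trans_le le_top)) h.le,
    fun H => h.not_ge H.encard_le⟩

theorem LtC.encard_lt {A B : ASet} (h : LtC A B) (hB : B.elts.Finite) :
    A.elts.encard < B.elts.encard :=
  lt_of_not_ge fun H => (ltC_iff.1 h).2 (leC_of_encard_le hB H)

theorem ltC_of_finite {A B : ASet} (hA : A.elts.Finite) (hB : B.elts.Infinite) : LtC A B :=
  ltC_of_encard_lt (by rw [hB.encard_eq]; exact hA.encard_lt_top)

theorem eqC_iff_encard {A B : ASet} (hB : B.elts.Finite) :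
    EqC A B ↔ A.elts.encard = B.elts.encard :=
  ⟨fun h => h.1.encard_le.antisymm h.2.encard_le, fun h =>
    ⟨leC_of_encard_le (encard_lt_top_iff.1 (h ▸ hB.encard_lt_top)) h.le,
      leC_of_encard_le hB h.ge⟩⟩

theorem finite_powerset {A : ASet} (hA : A.elts.Finite) : (powerset A).elts.Finite :=
  Finite.of_finite_image (hA.finite_subsets.subset (by
    rintro _ ⟨x, hx, rfl⟩
    exact mem_powerset.1 hx)) elts_injective.injOn

/-- The bit with index `Nat.pair n k` records whether the `n`th approximation has code `k` in a
fixed numbering of `HF n`. -/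
theorem exists_continuous_injective_bool :
    ∃ c : ASet → ℕ → Bool, Continuous c ∧ Function.Injective c := by
  classical
  choose e he using fun n => exists_injective_nat (HF n)
  let G : ASet → ℕ × ℕ → Bool := fun x q => decide (e q.1 (x.approx q.1) = q.2)
  refine ⟨fun x m => G x m.unpair, continuous_pi fun m => ?_,
    fun x y hxy => eq_of_forall_approx fun n => he n ?_⟩
  · exact (continuous_of_discreteTopology
      (f := fun h : HF m.unpair.1 => decide (e m.unpair.1 h = m.unpair.2))).comp
      (continuous_approx _)
  · have := congrFun hxy (Nat.pair n (e n (y.approx n)))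
    simp only [Nat.unpair_pair] at this
    simpa [G] using this

/-- Perfect set theorem: the uncountable closed set `B` contains a Cantor set, and the whole
universe embeds in Cantor space. -/
theorem leC_of_not_countable {B : ASet} (hB : ¬ B.elts.Countable) (A : ASet) : LeC A B := by
  obtain ⟨c, hc, hci⟩ := exists_continuous_injective_bool
  obtain ⟨f, hfB, hf, hfi⟩ := (isClosed_elts B).exists_nat_bool_injection_of_not_countable hB
  exact leC_iff.2 ⟨f ∘ c, (hf.comp hc).continuousOn, (hfi.comp hci).injOn,
    fun x _ => hfB ⟨_, rfl⟩⟩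

theorem ltC_of_countable {A B : ASet} (hA : A.elts.Countable) (hB : ¬ B.elts.Countable) :
    LtC A B :=
  ltC_iff.2 ⟨leC_of_not_countable hB A, fun h => hB (h.countable hA)⟩

theorem LtC.countable {A B : ASet} (h : LtC A B) : A.elts.Countable := by
  by_contra H
  exact (ltC_iff.1 h).2 (leC_of_not_countable H B)

/-! ### Infinity in the sense of Dedekind -/

theorem infinite_of_isInfinite {A : ASet} (h : IsInfinite A) : A.elts.Infinite := by
  intro hA
  obtain ⟨B, hBA, hne, hbij⟩ := h
  obtain ⟨g, -, hgi, hg⟩ := exists_of_inBijection hbij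
  refine hne (elts_injective ((hA.subset (subset_iff_elts.1 hBA)).eq_of_subset_of_encard_le (subset_iff_elts.1 hBA) ?_))
  rw [← hg, hgi.encard_image]

theorem isInfinite_of_leC {A B : ASet} (hBA : B ⊆ A) (hne : B ≠ A) (h : LeC A B) :
    IsInfinite A := by
  obtain ⟨g, hg, hgi, hgm⟩ := leC_iff.1 h
  have hcl : IsClosed (g '' A.elts) :=
    ((isClosed_elts A).isCompact.image_of_continuousOn hg).isClosed
  have hsub : g '' A.elts ⊆ B.elts := image_subset_iff.2 hgm
  refine ⟨ofClosed (g '' A.elts), ?_, ?_, inBijection_of_continuousOn hg hgi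
    (elts_ofClosed hcl).symm⟩
  · rw [subset_iff_elts, elts_ofClosed hcl]
    exact hsub.trans hBA
  · intro H
    refine hne (elts_injective (Subset.antisymm hBA ?_))
    rw [← H, elts_ofClosed hcl]
    exact hsub

/-- The part of `A` in the neighborhood of `x` given by the `n`th approximation. -/
def localPart (A : ASet) (n : ℕ) (x : ASet) : ASet := ofClosed (A.elts ∩ ball n x)

theorem mem_localPart {A x y : ASet} {n : ℕ} :
    y ∈ localPart A n x ↔ y ∈ A ∧ y.approx n = x.approx n :=
  mem_ofClosed ((isClosed_elts A).inter (isClopen_ball n x).isClosed)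

/-- A clopen ball separates two points. When `A` is infinite or uncountable one half inherits this,
and `A` embeds in that proper subset if its size permits. -/
theorem exists_split {A : ASet} (hA : A.elts.Nontrivial) :
    ∃ B C : ASet, B ⊆ A ∧ B ≠ A ∧ C ⊆ A ∧ C ≠ A ∧ A.elts = B.elts ∪ C.elts := by
  obtain ⟨x, hx, y, hy, hxy⟩ := hA
  obtain ⟨n, hn⟩ := exists_approx_ne hxy
  have hmem : ∀ z, z ∈ ofClosed (A.elts ∩ (ball n x)ᶜ) ↔ z ∈ A ∧ ¬ z.approx n = x.approx n :=
    fun z => mem_ofClosed ((isClosed_elts A).inter (isClopen_ball n x).compl.isClosed)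
  refine ⟨localPart A n x, ofClosed (A.elts ∩ (ball n x)ᶜ), fun z hz => (mem_localPart.1 hz).1,
    fun h => hn ?_, fun z hz => ((hmem z).1 hz).1, fun h => ?_, ?_⟩
  · exact (mem_localPart.1 (h.symm ▸ hy : y ∈ localPart A n x)).2.symm
  · exact ((hmem x).1 (h.symm ▸ hx)).2 rfl
  · ext z
    simp only [mem_elts, Set.mem_union, mem_localPart, hmem]
    tauto

theorem isInfinite_of_not_countable {A : ASet} (hA : ¬ A.elts.Countable) : IsInfinite A := by
  obtain ⟨B, C, hB, hB', hC, hC', h⟩ := exists_split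
    (Set.Infinite.nontrivial fun h => hA h.countable)
  by_cases hBc : B.elts.Countable
  · refine isInfinite_of_leC hC hC' (leC_of_not_countable (fun hCc => hA ?_) A)
    exact h ▸ hBc.union hCc
  · exact isInfinite_of_leC hB hB' (leC_of_not_countable hBc A)

/-! ### Sets with one limit point -/

theorem exists_approx_ne_of_finite {S : Set ASet} (hS : S.Finite) {p : ASet} (hp : p ∉ S) :
    ∃ N, ∀ x ∈ S, x.approx N ≠ p.approx N := by
  obtain ⟨N, -, hN⟩ := (nhds_hasBasis p).mem_iff.1 (hS.isClosed.isOpen_compl.mem_nhds hp)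
  exact ⟨N, fun x hx h => hN h hx⟩

theorem exists_accPt {S A : Set ASet} (hA : IsClosed A) (hSA : S ⊆ A) (hS : S.Infinite) :
    ∃ p ∈ A, ∀ n, ∃ y ∈ S, y.approx n = p.approx n ∧ y ≠ p := by
  obtain ⟨p, hp, hacc⟩ := hS.exists_accPt_of_subset_isCompact hA.isCompact hSA
  refine ⟨p, hp, fun n => ?_⟩
  obtain ⟨y, hy, hne⟩ := accPt_iff_nhds.1 hacc _ ((isClopen_ball n p).isOpen.mem_nhds rfl)
  exact ⟨y, hy.2, hy.1, hne⟩

/-- All points of `K` except possibly `p ∈ K` are isolated. -/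
def IsOneLimit (K p : ASet) : Prop :=
  p ∈ K ∧ ∀ x ∈ K, x ≠ p → ∃ n, ∀ y ∈ K, y.approx n = x.approx n → y = x

theorem exists_injective_seq {L q : ASet}
    (hq : ∀ n, ∃ y ∈ L, y.approx n = q.approx n ∧ y ≠ q) :
    ∃ y : ℕ → ASet, Function.Injective y ∧ ∀ k, y k ∈ L ∧ (y k).approx k = q.approx k ∧ y k ≠ q := by
  choose F hFL hFn hFq using hq
  choose G hG using fun n => exists_approx_ne (hFq n)
  have hGn : ∀ n, n < G n := fun n => by
    by_contra! h
    exact hG n (approx_eq_of_le h (hFn n))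
  -- Each level is chosen where the previous point has already separated from `q`, while the next
  -- point still agrees with `q` there; this forces injectivity.
  let l : ℕ → ℕ := fun k => Nat.rec 0 (fun _ n => G n) k
  have hl : StrictMono l := strictMono_nat_of_lt_succ fun k => hGn (l k)
  refine ⟨fun k => F (l k), Function.Injective.of_lt_imp_ne fun j k hjk h => hG (l j) ?_,
    fun k => ⟨hFL _, approx_eq_of_le hl.le_apply (hFn _), hFq _⟩⟩
  have h' : F (l j) = F (l k) := h
  rw [h']
  exact approx_eq_of_le (hl.monotone (Nat.succ_le_of_lt hjk) : l (j + 1) ≤ l k) (hFn (l k))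

/-- Send `p` to an accumulation point `q` of `L` and the other points, enumerated by `e`, along a
sequence converging to `q`. Continuity matters only at `p`, where finitely many points have `e z <
n` and can be avoided. -/
theorem IsOneLimit.leC {K p L : ASet} (hK : IsOneLimit K p) (hc : K.elts.Countable)
    (hL : L.elts.Infinite) : LeC K L := by
  classical
  obtain ⟨q, hqL, hq⟩ := exists_accPt (isClosed_elts L) Subset.rfl hL
  obtain ⟨y, hyi, hy⟩ := exists_injective_seq hq
  obtain ⟨e, he⟩ := countable_iff_exists_injOn.1 hc
  refine leC_iff.2 ⟨fun x => if x = p then q else y (e x), ?_, ?_, ?_⟩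
  · refine continuousOn_iff_approx.2 fun x hx n => ?_
    by_cases hxp : x = p
    · subst hxp
      have hfin : {z | z ∈ K.elts \ {x} ∧ e z < n}.Finite :=
        Finite.of_finite_image ((finite_lt_nat n).subset (by rintro _ ⟨z, hz, rfl⟩; exact hz.2))
          (he.mono fun z hz => hz.1.1)
      obtain ⟨N, hN⟩ := exists_approx_ne_of_finite hfin (p := x) fun h => h.1.2 rfl
      refine ⟨N, fun z hz hzx => ?_⟩
      by_cases h : z = x
      · rw [h]
      · simp only [h, if_false, if_true]
        refine approx_eq_of_le (not_lt.1 fun hlt => ?_) (hy (e z)).2.1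
        exact hN z ⟨⟨hz, h⟩, hlt⟩ hzx
    · obtain ⟨N, hN⟩ := hK.2 x hx hxp
      exact ⟨N, fun z hz hzx => by rw [hN z hz hzx]⟩
  · intro a ha b hb hab
    by_cases hap : a = p <;> by_cases hbp : b = p <;> simp only [hap, hbp, if_true, if_false] at hab
    · rw [hap, hbp]
    · exact absurd hab.symm (hy _).2.2
    · exact absurd hab (hy _).2.2
    · exact he ha hb (hyi hab)
  · intro x _
    by_cases hxp : x = p
    · simpa [hxp] using hqL
    · simpa [hxp] using (hy (e x)).1

/-- Outside any ball around `q` the set `L` is finite, since an accumulation point there would be a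
second limit. Injectivity pulls this back to a finite set, which keeps away from `p`. -/
theorem IsOneLimit.continuousOn {K p L q : ASet} (hK : IsOneLimit K p) (hL : IsOneLimit L q)
    {g : ASet → ASet} (hg : InjOn g K.elts) (hm : MapsTo g K.elts L.elts) (hp : g p = q) :
    ContinuousOn g K.elts := by
  refine continuousOn_iff_approx.2 fun x hx n => ?_
  by_cases hxp : x = p
  · subst hxp
    have hfin : {y | y ∈ L.elts ∧ y.approx n ≠ q.approx n}.Finite := by
      by_contra H
      have hcl : IsClosed {y | y ∈ L.elts ∧ y.approx n ≠ q.approx n} :=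
        (isClosed_elts L).inter (isClopen_ball n q).compl.isClosed
      obtain ⟨z, hz, hacc⟩ := exists_accPt hcl Subset.rfl H
      obtain ⟨m, hm⟩ := hL.2 z hz.1 (by rintro rfl; exact hz.2 rfl)
      obtain ⟨y, hy, hyz, hne⟩ := hacc m
      exact hne (hm y hy.1 hyz)
    have hfin' : {z | z ∈ K.elts ∧ (g z).approx n ≠ q.approx n}.Finite :=
      Finite.of_finite_image (hfin.subset (by
        rintro _ ⟨z, hz, rfl⟩
        exact ⟨hm hz.1, hz.2⟩)) (hg.mono fun z hz => hz.1)
    obtain ⟨N, hN⟩ := exists_approx_ne_of_finite hfin' (p := x) fun h => h.2 (by rw [hp])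
    refine ⟨N, fun z hz hzx => ?_⟩
    by_contra h
    exact hN z ⟨hz, by rwa [hp] at h⟩ hzx
  · obtain ⟨N, hN⟩ := hK.2 x hx hxp
    exact ⟨N, fun z hz hzx => by rw [hN z hz hzx]⟩

theorem IsOneLimit.inBijection {K p L q : ASet} (hK : IsOneLimit K p) (hL : IsOneLimit L q)
    (hKc : K.elts.Countable) (hLc : L.elts.Countable) (hKi : K.elts.Infinite)
    (hLi : L.elts.Infinite) : InBijection K L := by
  classical
  have := (hKc.mono sdiff_subset : (K.elts \ {p}).Countable).to_subtype
  have := (hLc.mono sdiff_subset : (L.elts \ {q}).Countable).to_subtype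
  have := (hKi.sdiff (finite_singleton p)).to_subtype
  have := (hLi.sdiff (finite_singleton q)).to_subtype
  obtain ⟨e⟩ : Nonempty (↥(K.elts \ {p}) ≃ ↥(L.elts \ {q})) := nonempty_equiv_of_countable
  let g : ASet → ASet := fun x => if h : x ∈ K.elts \ {p} then e ⟨x, h⟩ else q
  have hgp : g p = q := by simp [g]
  have hg : ∀ x (h : x ∈ K.elts \ {p}), g x = e ⟨x, h⟩ := fun x h => dif_pos h
  have hinj : InjOn g K.elts := by
    intro a ha b hb hab
    by_cases hap : a = p <;> by_cases hbp : b = p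
    · rw [hap, hbp]
    · rw [hap, hgp, hg b ⟨hb, hbp⟩] at hab
      exact absurd hab.symm (e _).2.2
    · rw [hbp, hgp, hg a ⟨ha, hap⟩] at hab
      exact absurd hab (e _).2.2
    · rw [hg a ⟨ha, hap⟩, hg b ⟨hb, hbp⟩] at hab
      exact congrArg Subtype.val (e.injective (Subtype.ext hab))
  have hm : MapsTo g K.elts L.elts := by
    intro x hx
    by_cases hxp : x = p
    · rw [hxp, hgp]; exact hL.1
    · rw [hg x ⟨hx, hxp⟩]; exact (e _).2.1
  refine inBijection_of_continuousOn (hK.continuousOn hL hinj hm hgp) hinj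
    (Subset.antisymm (image_subset_iff.2 hm) fun y hy => ?_)
  by_cases hyq : y = q
  · exact ⟨p, hK.1, hgp.trans hyq.symm⟩
  · refine ⟨e.symm ⟨y, hy, hyq⟩, (e.symm _).2.1, ?_⟩
    rw [hg _ (e.symm _).2]
    simp

/-! ### The set `ω` -/

theorem mem_nOrd {n : ℕ} {x : ASet} : x ∈ nOrd n ↔ ∃ m < n, x = nOrd m := by
  induction n with
  | zero => simp [nOrd, not_mem_empty]
  | succ n ih =>
    rw [nOrd, mem_union, ih, mem_single]
    constructor
    · rintro (⟨m, hm, rfl⟩ | rfl)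
      · exact ⟨m, by omega, rfl⟩
      · exact ⟨n, by omega, rfl⟩
    · rintro ⟨m, hm, rfl⟩
      rcases Nat.lt_succ_iff_lt_or_eq.1 hm with h | rfl
      · exact .inl ⟨m, h, rfl⟩
      · exact .inr rfl

theorem nOrd_injective : Function.Injective nOrd := by
  refine Function.Injective.of_lt_imp_ne fun k m => ?_
  induction m using Nat.strong_induction_on generalizing k with
  | _ m ih =>
    intro hk h
    have hkm : nOrd k ∈ nOrd m := mem_nOrd.2 ⟨k, hk, rfl⟩
    rw [← h] at hkm
    obtain ⟨j, hj, hjk⟩ := mem_nOrd.1 hkm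
    exact ih k hk j hj hjk.symm

theorem nOrd_mem_nOrd {m n : ℕ} : nOrd m ∈ nOrd n ↔ m < n :=
  ⟨fun h => by obtain ⟨k, hk, hkm⟩ := mem_nOrd.1 h; rwa [nOrd_injective hkm],
    fun h => mem_nOrd.2 ⟨m, h, rfl⟩⟩

theorem approx_nOrd {k n : ℕ} (h : k ≤ n) : (nOrd n).approx k = (nOrd k).approx k := by
  induction k generalizing n with
  | zero => rfl
  | succ k ih =>
    refine approx_succ_eq_iff.2 ⟨fun x hx => ?_, fun x hx => ?_⟩
    · obtain ⟨m, hm, rfl⟩ := mem_nOrd.1 hx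
      rcases lt_or_ge m k with hmk | hmk
      · exact ⟨nOrd m, nOrd_mem_nOrd.2 (by omega), rfl⟩
      · exact ⟨nOrd k, nOrd_mem_nOrd.2 (by omega), (ih hmk).symm⟩
    · obtain ⟨m, hm, rfl⟩ := mem_nOrd.1 hx
      exact ⟨nOrd m, nOrd_mem_nOrd.2 (by omega), rfl⟩

theorem nOrd_mem_omega (n : ℕ) : nOrd n ∈ omega := mem_hull_iff.2 fun _ => ⟨_, ⟨n, rfl⟩, rfl⟩

/-- The finite ordinals converge to `ω` itself. Taking the smallest set containing them therefore
adds exactly the point `ω`, and `ω ∈ ω`. -/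
theorem approx_omega {k n : ℕ} (h : k ≤ n) : (nOrd n).approx k = omega.approx k := by
  rw [approx_nOrd h]
  cases k with
  | zero => rfl
  | succ k =>
    refine approx_succ_eq_iff.2 ⟨fun x hx => ?_, fun x hx => ?_⟩
    · obtain ⟨m, -, rfl⟩ := mem_nOrd.1 hx
      exact ⟨_, nOrd_mem_omega m, rfl⟩
    · obtain ⟨_, ⟨m, rfl⟩, hm⟩ := mem_hull_iff.1 hx k
      rcases lt_or_ge m k with hmk | hmk
      · exact ⟨nOrd m, nOrd_mem_nOrd.2 (by omega), hm⟩
      · exact ⟨nOrd k, nOrd_mem_nOrd.2 (by omega), (approx_nOrd hmk).symm.trans hm⟩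

theorem omega_mem_omega : omega ∈ omega :=
  mem_hull_iff.2 fun n => ⟨_, ⟨n, rfl⟩, approx_omega le_rfl⟩

/-- A point other than `ω` differs from it at some level `k`, where all ordinals from `k` on look
like `ω`; only finitely many ordinals could approach it. -/
theorem isClosed_insert_nOrd (T : Set ℕ) : IsClosed (insert omega (nOrd '' T)) := by
  refine isClosed_iff_approx.2 fun x hx => ?_
  by_contra hxT
  simp only [mem_insert_iff, not_or] at hxT
  obtain ⟨k, hk⟩ := exists_approx_ne hxT.1
  obtain ⟨N, hN⟩ := exists_approx_ne_of_finite (S := nOrd '' (T ∩ Iio k))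
    (((finite_Iio k).inter_of_right T).image _)
    fun h => hxT.2 (image_mono inter_subset_left h)
  obtain ⟨y, hy, hyx⟩ := hx (max k N)
  have hyk := approx_eq_of_le (le_max_left k N) hyx
  have hyN := approx_eq_of_le (le_max_right k N) hyx
  rcases hy with rfl | ⟨n, hn, rfl⟩
  · exact hk hyk.symm
  · rcases lt_or_ge n k with hnk | hnk
    · exact hN _ ⟨n, ⟨hn, hnk⟩, rfl⟩ hyN
    · exact hk (hyk.symm.trans (approx_omega hnk))

theorem mem_omega {x : ASet} : x ∈ omega ↔ x = omega ∨ ∃ n, x = nOrd n := by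
  constructor
  · intro hx
    have := isClosed_iff_approx.1 (isClosed_insert_nOrd univ) x fun n => by
      obtain ⟨_, ⟨m, rfl⟩, hm⟩ := mem_hull_iff.1 hx n
      exact ⟨nOrd m, .inr ⟨m, trivial, rfl⟩, hm⟩
    rcases this with h | ⟨n, -, h⟩
    · exact .inl h
    · exact .inr ⟨n, h.symm⟩
  · rintro (rfl | ⟨n, rfl⟩)
    · exact omega_mem_omega
    · exact nOrd_mem_omega n

theorem nOrd_ne_omega (n : ℕ) : nOrd n ≠ omega := fun h => by
  have := omega_mem_omega
  rw [← h, nOrd_mem_nOrd] at this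
  exact lt_irrefl n this

theorem omega_not_mem_nOrd (n : ℕ) : omega ∉ nOrd n := fun h => by
  obtain ⟨m, -, hm⟩ := mem_nOrd.1 h
  exact nOrd_ne_omega m hm.symm

theorem isolated_nOrd (n : ℕ) : ∃ k, ∀ y ∈ omega, y.approx k = (nOrd n).approx k → y = nOrd n := by
  obtain ⟨k, hk⟩ := exists_approx_ne (nOrd_ne_omega n)
  obtain ⟨N, hN⟩ := exists_approx_ne_of_finite (S := nOrd '' (Iio k \ {n})) (p := nOrd n)
    (((finite_Iio k).sdiff).image _) (by
      rintro ⟨m, hm, h⟩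
      exact hm.2 (nOrd_injective h))
  refine ⟨max k N, fun y hy hyn => ?_⟩
  have hyk := approx_eq_of_le (le_max_left k N) hyn
  have hyN := approx_eq_of_le (le_max_right k N) hyn
  rcases mem_omega.1 hy with rfl | ⟨m, rfl⟩
  · exact absurd hyk.symm hk
  · by_contra hne
    rcases lt_or_ge m k with hmk | hmk
    · exact hN _ ⟨m, ⟨hmk, fun h => hne (by rw [h])⟩, rfl⟩ hyN
    · exact hk (hyk.symm.trans (approx_omega hmk))

theorem isOneLimit_omega : IsOneLimit omega omega := by
  refine ⟨omega_mem_omega, fun x hx hne => ?_⟩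
  rcases mem_omega.1 hx with rfl | ⟨n, rfl⟩
  · exact absurd rfl hne
  · exact isolated_nOrd n

theorem countable_omega : omega.elts.Countable :=
  ((countable_range nOrd).insert omega).mono fun _ hx => (mem_omega.1 hx).imp id
    fun ⟨n, h⟩ => ⟨n, h.symm⟩

theorem infinite_omega : omega.elts.Infinite :=
  infinite_of_injective_forall_mem nOrd_injective nOrd_mem_omega

theorem omega_leC {A : ASet} (hA : A.elts.Infinite) : LeC omega A :=
  isOneLimit_omega.leC countable_omega hA

theorem encard_nOrd (n : ℕ) : (nOrd n).elts.encard = n := by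
  have : (nOrd n).elts = nOrd '' Iio n := by
    ext x
    simp [mem_nOrd, eq_comm]
  rw [this, nOrd_injective.injOn.encard_image, ← Finset.coe_Iio, encard_coe_eq_coe_finsetCard,
    Nat.card_Iio]

theorem finite_nOrd (n : ℕ) : (nOrd n).elts.Finite :=
  encard_lt_top_iff.1 (by rw [encard_nOrd]; exact ENat.natCast_lt_top n)

theorem not_countable_powerset_omega : ¬ (powerset omega).elts.Countable := by
  intro h
  let F : Set ℕ → ASet := fun T => ofClosed (insert omega (nOrd '' T))
  have hF : ∀ T n, nOrd n ∈ F T ↔ n ∈ T := fun T n => by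
    simp [F, mem_ofClosed (isClosed_insert_nOrd T), nOrd_ne_omega, nOrd_injective.eq_iff]
  have hinj : Function.Injective F := fun T T' h => by
    ext n
    rw [← hF T, h, hF]
  have hm : MapsTo F univ (powerset omega).elts := by
    intro T _
    refine mem_powerset.2 fun x hx => ?_
    rw [mem_ofClosed (isClosed_insert_nOrd T)] at hx
    rcases hx with rfl | ⟨n, -, rfl⟩
    · exact omega_mem_omega
    · exact nOrd_mem_omega n
  have := countable_univ_iff.1 (hm.countable_of_injOn hinj.injOn h)
  obtain ⟨f, hf⟩ := exists_injective_nat (Set ℕ)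
  exact Function.cantor_injective f hf

theorem eqC_powerset_omega_iff {A : ASet} : EqC A (powerset omega) ↔ ¬ A.elts.Countable :=
  ⟨fun h hA => not_countable_powerset_omega (h.2.countable hA), fun h =>
    ⟨leC_of_not_countable not_countable_powerset_omega A, leC_of_not_countable h _⟩⟩

theorem isInfinite_of_eqC_omega {A : ASet} (h : EqC A omega) : IsInfinite A := by
  have hA : A.elts.Infinite := fun hfin => infinite_omega (h.2.finite hfin)
  obtain ⟨B, C, hB, hB', hC, hC', hBC⟩ := exists_split hA.nontrivial
  by_cases hBf : B.elts.Finite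
  · refine isInfinite_of_leC hC hC' (h.1.trans (omega_leC fun hCf => hA ?_))
    exact hBC ▸ hBf.union hCf
  · exact isInfinite_of_leC hB hB' (h.1.trans (omega_leC hBf))

/-- An embedding into `ω` sends every accumulation point to the only limit `ω`, so by injectivity
`A` has just one. Sets with one limit point are then matched by any bijection of the remaining
points. -/
theorem inBijection_omega {A : ASet} (h : LeC A omega) (hA : A.elts.Infinite) :
    InBijection A omega := by
  obtain ⟨p, hp, hacc⟩ := exists_accPt (isClosed_elts A) Subset.rfl hA
  obtain ⟨f, hf, hfi, hfm⟩ := leC_iff.1 h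
  have key : ∀ x ∈ A, (∀ n, ∃ y ∈ A, y.approx n = x.approx n ∧ y ≠ x) → f x = omega := by
    intro x hx hacc
    by_contra hne
    obtain ⟨n, hn⟩ := isOneLimit_omega.2 (f x) (hfm hx) hne
    obtain ⟨N, hN⟩ := continuousOn_iff_approx.1 hf x hx n
    obtain ⟨y, hy, hyx, hyne⟩ := hacc N
    exact hyne (hfi hy hx (hn _ (hfm hy) (hN y hy hyx)))
  have hAp : IsOneLimit A p := by
    refine ⟨hp, fun x hx hne => ?_⟩
    by_contra! H
    exact hne (hfi hx hp ((key x hx H).trans (key p hp hacc).symm))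
  exact hAp.inBijection isOneLimit_omega (h.countable countable_omega) countable_omega hA
    infinite_omega

/-! ### Well-orderings and cardinals -/

/-- Minima exist even for subsets that are not closed. The minimum of the closure lies in `B`:
otherwise points of `B`, all above it, would come arbitrarily close, against upward isolation. -/
theorem WellOrders.exists_min {R A : ASet} (h : WellOrders R A) {B : Set ASet} (hB : B.Nonempty)
    (hBA : B ⊆ A.elts) : ∃ m ∈ B, ∀ x ∈ B, x ≠ m → opair m x ∈ R := by
  have hsub : closure B ⊆ A.elts := closure_minimal hBA (isClosed_elts A)
  have hmem : ∀ x, x ∈ ofClosed (closure B) ↔ x ∈ closure B := fun x => mem_ofClosed isClosed_closure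
  obtain ⟨m, hm, hmin⟩ := h.2.1 (ofClosed (closure B)) (fun x hx => hsub ((hmem x).1 hx)) (by
    obtain ⟨b, hb⟩ := hB
    exact fun h => eq_empty_iff.1 h b ((hmem b).2 (subset_closure hb)))
  rw [hmem] at hm
  refine ⟨m, ?_, fun x hx => hmin x ((hmem x).2 (subset_closure hx))⟩
  by_contra hmB
  obtain ⟨n, hn⟩ := h.2.2 m (hsub hm)
  obtain ⟨y, hyn, hy⟩ := mem_closure_iff.1 hm _ (isClopen_ball n m).isOpen (mem_ball_self n m)
  have hne : y ≠ m := by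
    rintro rfl
    exact hmB hy
  exact hn y (hBA hy) hne hyn (hmin y ((hmem y).2 (subset_closure hy)) hne)

/-- Code `x` by the node of the tree that witnesses its upward isolation. Of two distinct points
with the same code, the upper one would lie in the isolating neighborhood of the lower. -/
theorem WellOrders.countable {R A : ASet} (h : WellOrders R A) : A.elts.Countable := by
  choose! n hn using h.2.2
  let F : ASet → Σ k, HF k := fun x => ⟨n x, x.approx (n x)⟩
  have key : ∀ x ∈ A, ∀ y ∈ A, F x = F y → y ≠ x → opair x y ∉ R := by
    intro x hx y hy hxy hne
    refine hn x hx y hy hne ?_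
    obtain ⟨h1, h2⟩ := Sigma.mk.inj_iff.1 hxy
    have h3 : ∀ k, n x = k → HEq (x.approx (n x)) (y.approx k) → y.approx (n x) = x.approx (n x) := by
      rintro k rfl h
      exact (eq_of_heq h).symm
    exact h3 _ h1 h2
  have hF : InjOn F A.elts := by
    intro x hx y hy hxy
    by_contra hne
    rcases h.1.2.2.2 x hx y hy hne with h | h
    · exact key x hx y hy hxy (Ne.symm hne) h
    · exact key y hy x hx hxy.symm hne h
  exact (mapsTo_univ F A.elts).countable_of_injOn hF countable_univ

theorem isCardinal_of_not_countable {A : ASet} (hA : ¬ A.elts.Countable) : IsCardinal A :=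
  .inr fun ⟨_, hR⟩ => hA hR.countable

/-- No ordering has to be constructed: a set that cannot be well-ordered is a cardinal by
definition, and under any well-ordering proper initial segments have fewer elements. -/
theorem isCardinal_of_finite {A : ASet} (hA : A.elts.Finite) : IsCardinal A := by
  by_cases h : WellOrderable A
  · obtain ⟨R, hR⟩ := h
    refine .inl ⟨R, hR, fun S hS hAS => hS.2.1 (elts_injective ?_)⟩
    exact (hA.subset (subset_iff_elts.1 hS.1)).eq_of_subset_of_encard_le (subset_iff_elts.1 hS.1)
      hAS.1.encard_le
  · exact .inr h

/-- Replaces a set by an equivalent cardinal, as sums and predecessors involve cardinals only. Take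
the least `a` missed by some proper initial segment `S` into which `A` embeds. A smaller segment
equivalent to `S` would miss some `b ∈ S`; minimality puts `a` below `b`, hence in `S`. -/
theorem exists_isCardinal_subset (A : ASet) : ∃ S, S ⊆ A ∧ IsCardinal S ∧ LeC A S := by
  by_cases hA : IsCardinal A
  · exact ⟨A, fun _ h => h, hA, .refl A⟩
  obtain ⟨hA, R, hR⟩ : (¬ ∃ R, IsWellOrderedCardinal A R) ∧ WellOrderable A := by
    simpa [IsCardinal, not_or] using hA
  obtain ⟨S₀, hS₀, hAS₀⟩ : ∃ S, IsProperInitialSegment R A S ∧ EqC A S := by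
    by_contra! H
    exact hA ⟨R, hR, H⟩
  let T : Set ASet := {a | a ∈ A ∧ ∃ S, IsProperInitialSegment R A S ∧ LeC A S ∧ a ∉ S}
  have hout : ∀ {S}, IsProperInitialSegment R A S → ∃ a ∈ A, a ∉ S := fun {S} hS => by
    by_contra! H
    exact hS.2.1 (ext_mem fun x => ⟨hS.1 x, H x⟩)
  have hT : T.Nonempty := by
    obtain ⟨a, ha, haS⟩ := hout hS₀
    exact ⟨a, ha, S₀, hS₀, hAS₀.1, haS⟩
  obtain ⟨a, ⟨ha, S, hS, hAS, haS⟩, hmin⟩ := hR.exists_min hT fun x hx => hx.1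
  let R' := ofClosed (R.elts ∩ (prod S S).elts)
  have hR' : ∀ {x y}, opair x y ∈ R' ↔ opair x y ∈ R ∧ x ∈ S ∧ y ∈ S := fun {x y} =>
    (mem_ofClosed ((isClosed_elts R).inter (isClosed_elts _))).trans
      (and_congr Iff.rfl opair_mem_prod)
  have hSA := hS.1
  obtain ⟨⟨-, hasymm, htrans, htot⟩, hwf, hup⟩ := hR
  refine ⟨S, hSA, .inl ⟨R', ⟨⟨fun x hx => ?_, ?_, ?_, ?_⟩, ?_, ?_⟩, fun S' hS' hSS' => ?_⟩, hAS⟩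
  · exact ((mem_ofClosed ((isClosed_elts R).inter (isClosed_elts _))).1 hx).2
  · exact fun x hx y hy hne hxy hyx =>
      hasymm x (hSA x hx) y (hSA y hy) hne (hR'.1 hxy).1 (hR'.1 hyx).1
  · exact fun x hx y hy z hz hxy hyz => hR'.2
      ⟨htrans x (hSA x hx) y (hSA y hy) z (hSA z hz) (hR'.1 hxy).1 (hR'.1 hyz).1, hx, hz⟩
  · exact fun x hx y hy hne => (htot x (hSA x hx) y (hSA y hy) hne).imp
      (fun h => hR'.2 ⟨h, hx, hy⟩) fun h => hR'.2 ⟨h, hy, hx⟩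
  · intro B hB hne
    obtain ⟨m, hm, hmB⟩ := hwf B (fun x hx => hSA x (hB x hx)) hne
    exact ⟨m, hm, fun x hx hxm => hR'.2 ⟨hmB x hx hxm, hB m hm, hB x hx⟩⟩
  · intro x hx
    obtain ⟨n, hn⟩ := hup x (hSA x hx)
    exact ⟨n, fun y hy hne hyn h => hn y (hSA y hy) hne hyn (hR'.1 h).1⟩
  · obtain ⟨b, hb, hbS'⟩ : ∃ b ∈ S, b ∉ S' := by
      by_contra! H
      exact hS'.2.1 (ext_mem fun x => ⟨hS'.1 x, H x⟩)
    have hbT : b ∈ T := by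
      refine ⟨hSA b hb, S', ⟨fun x hx => hSA x (hS'.1 x hx), ?_, ?_⟩, hAS.trans hSS'.1, hbS'⟩
      · rintro rfl
        exact hbS' (hSA b hb)
      · intro x hx y hy hyx
        have hyS := hS.2.2 x (hS'.1 x hx) y hy hyx
        exact hS'.2.2 x hx y hyS (hR'.2 ⟨hyx, hyS, hS'.1 x hx⟩)
    have hba : b ≠ a := by
      rintro rfl
      exact haS hb
    exact haS (hS.2.2 b hb a ha (hmin b hbT hba))

/-- The order is membership. It relates `ω` to itself, which is harmless. An initial segment
equivalent to `ω` is infinite, so it contains every finite ordinal and, being closed, also their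
limit. -/
theorem isCardinal_omega : IsCardinal omega := by
  let R := ofClosed ((fun p : ASet × ASet => opair p.1 p.2) ''
    ({p : ASet × ASet | p.1 ∈ p.2} ∩ omega.elts ×ˢ omega.elts))
  have hcl : IsClosed ((fun p : ASet × ASet => opair p.1 p.2) ''
      ({p : ASet × ASet | p.1 ∈ p.2} ∩ omega.elts ×ˢ omega.elts)) :=
    ((isClosed_mem.inter ((isClosed_elts _).prod (isClosed_elts _))).isCompact.image
      continuous_opair).isClosed
  have hR : ∀ {x y}, opair x y ∈ R ↔ x ∈ y ∧ x ∈ omega ∧ y ∈ omega := fun {x y} => by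
    rw [mem_ofClosed hcl]
    constructor
    · rintro ⟨⟨u, v⟩, ⟨huv, hu, hv⟩, h⟩
      obtain ⟨rfl, rfl⟩ := opair_inj.1 h
      exact ⟨huv, hu, hv⟩
    · exact fun h => ⟨(x, y), h, rfl⟩
  refine .inl ⟨R, ⟨⟨fun x hx => ?_, ?_, ?_, ?_⟩, ?_, ?_⟩, ?_⟩
  · obtain ⟨⟨u, v⟩, ⟨-, hu, hv⟩, rfl⟩ := (mem_ofClosed hcl).1 hx
    exact opair_mem_prod.2 ⟨hu, hv⟩
  · intro x hx y hy hne hxy hyx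
    rw [hR] at hxy hyx
    rcases mem_omega.1 hx with rfl | ⟨m, rfl⟩ <;> rcases mem_omega.1 hy with rfl | ⟨n, rfl⟩
    · exact hne rfl
    · exact omega_not_mem_nOrd n hxy.1
    · exact omega_not_mem_nOrd m hyx.1
    · have := nOrd_mem_nOrd.1 hxy.1
      have := nOrd_mem_nOrd.1 hyx.1
      omega
  · intro x hx y hy z hz hxy hyz
    rw [hR] at hxy hyz ⊢
    refine ⟨?_, hx, hz⟩
    rcases mem_omega.1 hz with rfl | ⟨n, rfl⟩
    · exact hx
    · obtain ⟨m, hm, rfl⟩ := mem_nOrd.1 hyz.1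
      obtain ⟨k, hk, rfl⟩ := mem_nOrd.1 hxy.1
      exact nOrd_mem_nOrd.2 (hk.trans hm)
  · intro x hx y hy hne
    simp only [hR, hx, hy, and_self, and_true]
    rcases mem_omega.1 hx with rfl | ⟨m, rfl⟩ <;> rcases mem_omega.1 hy with rfl | ⟨n, rfl⟩
    · exact absurd rfl hne
    · exact .inr hy
    · exact .inl hx
    · simp only [nOrd_mem_nOrd]
      exact lt_or_gt_of_ne fun h => hne (by rw [h])
  · intro B hB hne
    classical
    by_cases h : ∃ n, nOrd n ∈ B
    · refine ⟨_, Nat.find_spec h, fun x hx hxm => hR.2 ⟨?_, nOrd_mem_omega _, hB x hx⟩⟩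
      rcases mem_omega.1 (hB x hx) with rfl | ⟨m, rfl⟩
      · exact nOrd_mem_omega _
      · exact nOrd_mem_nOrd.2 (lt_of_le_of_ne (Nat.find_min' h hx) fun h => hxm (by rw [h]))
    · obtain ⟨b, hb⟩ : ∃ b, b ∈ B := by
        by_contra! H
        exact hne (eq_empty_iff.2 H)
      have hom : ∀ x ∈ B, x = omega := fun x hx => (mem_omega.1 (hB x hx)).resolve_right
        fun ⟨n, hn⟩ => h ⟨n, hn ▸ hx⟩
      exact ⟨b, hb, fun x hx hxb => absurd ((hom x hx).trans (hom b hb).symm) hxb⟩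
  · intro x hx
    rcases mem_omega.1 hx with rfl | ⟨m, rfl⟩
    · refine ⟨0, fun y hy hne _ h => ?_⟩
      obtain ⟨n, rfl⟩ := (mem_omega.1 hy).resolve_left hne
      exact omega_not_mem_nOrd n (hR.1 h).1
    · obtain ⟨k, hk⟩ := isolated_nOrd m
      exact ⟨k, fun y hy hne hyk => absurd (hk y hy hyk) hne⟩
  · intro S hS h
    have hinf : S.elts.Infinite := fun hfin => infinite_omega (h.1.finite hfin)
    have hall : ∀ n, nOrd n ∈ S := by
      intro n
      obtain ⟨x, hx, hxn⟩ : ∃ x ∈ S, x ∉ nOrd (n + 1) := by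
        by_contra! H
        exact hinf ((finite_nOrd (n + 1)).subset H)
      refine hS.2.2 x hx _ (nOrd_mem_omega n) (hR.2 ⟨?_, nOrd_mem_omega n, hS.1 x hx⟩)
      rcases mem_omega.1 (hS.1 x hx) with rfl | ⟨m, rfl⟩
      · exact nOrd_mem_omega n
      · rw [nOrd_mem_nOrd] at hxn ⊢
        omega
    refine hS.2.1 (ext_mem fun x => ⟨hS.1 x, fun hx => ?_⟩)
    refine isClosed_iff_approx.1 (isClosed_elts S) x fun k => ?_
    obtain ⟨_, ⟨n, rfl⟩, hn⟩ := mem_hull_iff.1 hx k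
    exact ⟨_, hall n, hn⟩

/-! ### Sets containing two disjoint copies of themselves -/

/-- A Cantor scheme: each binary sequence `s` picks one of the two self-embeddings at every stage.
The images of the compositions are nested nonempty compact sets, so they share a point. -/
theorem not_countable_of_two_copies {A B C : ASet} (hA : A ≠ empty) (hAB : LeC A B) (hAC : LeC A C)
    (hBA : B ⊆ A) (hCA : C ⊆ A) (hBC : ∀ x ∈ B, x ∉ C) : ¬ A.elts.Countable := by
  obtain ⟨f, hf, hfi, hfm⟩ := leC_iff.1 hAB
  obtain ⟨g, hg, hgi, hgm⟩ := leC_iff.1 hAC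
  let φ : Bool → ASet → ASet := fun b => if b then f else g
  have hφ : ∀ b, ContinuousOn (φ b) A.elts := by
    rintro (_ | _)
    exacts [hg, hf]
  have hφi : ∀ b, InjOn (φ b) A.elts := by
    rintro (_ | _)
    exacts [hgi, hfi]
  have hφm : ∀ b, MapsTo (φ b) A.elts A.elts := by
    rintro (_ | _)
    exacts [fun x hx => hCA _ (hgm hx), fun x hx => hBA _ (hfm hx)]
  have hφd : ∀ b c, b ≠ c → ∀ x ∈ A, ∀ y ∈ A, φ b x ≠ φ c y := by
    rintro (_ | _) (_ | _) hne x hx y hy h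
    · exact hne rfl
    · exact hBC _ (hfm hy) ((show g x = f y from h) ▸ hgm hx)
    · exact hBC _ (hfm hx) ((show f x = g y from h) ▸ hgm hy)
    · exact hne rfl
  -- `H s n` is `φ (s 0) ∘ ⋯ ∘ φ (s (n - 1))`; new maps enter on the inside, so the images decrease.
  let H : (ℕ → Bool) → ℕ → ASet → ASet := fun s n => Nat.rec id (fun k F => F ∘ φ (s k)) n
  have hHs : ∀ s n, H s (n + 1) = H s n ∘ φ (s n) := fun _ _ => rfl
  have hHc : ∀ s n, ContinuousOn (H s n) A.elts := by
    intro s n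
    induction n with
    | zero => exact continuousOn_id
    | succ n ih => rw [hHs]; exact ih.comp (hφ _) (hφm _)
  have hHi : ∀ s n, InjOn (H s n) A.elts := by
    intro s n
    induction n with
    | zero => exact injOn_id _
    | succ n ih => rw [hHs]; exact ih.comp (hφi _) (hφm _)
  have hHm : ∀ s n, MapsTo (H s n) A.elts A.elts := by
    intro s n
    induction n with
    | zero => exact mapsTo_id _
    | succ n ih => rw [hHs]; exact ih.comp (hφm _)
  have hHe : ∀ s t n, (∀ k < n, s k = t k) → H s n = H t n := by
    intro s t n
    induction n with
    | zero => exact fun _ => rfl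
    | succ n ih => intro h; rw [hHs, hHs, ih fun k hk => h k (by omega), h n (by omega)]
  have hne : A.elts.Nonempty := by
    by_contra h
    exact hA (eq_empty_iff.2 fun x hx => h ⟨x, hx⟩)
  have hex : ∀ s, ∃ x, ∀ n, x ∈ H s n '' A.elts := by
    intro s
    have hcl : ∀ n, IsClosed (H s n '' A.elts) := fun n =>
      ((isClosed_elts A).isCompact.image_of_continuousOn (hHc s n)).isClosed
    have hanti : ∀ n, H s (n + 1) '' A.elts ⊆ H s n '' A.elts := by
      rintro n _ ⟨a, ha, rfl⟩
      exact ⟨_, hφm (s n) ha, rfl⟩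
    obtain ⟨x, hx⟩ := IsCompact.nonempty_iInter_of_sequence_nonempty_isCompact_isClosed
      (fun n => H s n '' A.elts) hanti (fun n => hne.image _) (hcl 0).isCompact hcl
    exact ⟨x, mem_iInter.1 hx⟩
  choose x hx using hex
  have hxi : Function.Injective x := by
    intro s t hst
    by_contra h
    have hd : ∃ n, s n ≠ t n := by
      by_contra! H
      exact h (funext H)
    classical
    -- At the first disagreement the outer compositions coincide and are injective, while the next
    -- maps have disjoint ranges.
    obtain ⟨a, ha, hax⟩ := hx s (Nat.find hd + 1)
    obtain ⟨b, hb, hbx⟩ := hx t (Nat.find hd + 1)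
    rw [hHs] at hax hbx
    rw [← hHe s t _ fun k hk => not_not.1 (Nat.find_min hd hk)] at hbx
    exact hφd _ _ (Nat.find_spec hd) a ha b hb
      (hHi s _ (hφm _ ha) (hφm _ hb) (hax.trans (hst.trans hbx.symm)))
  intro hc
  have hxA : MapsTo x univ A.elts := fun s _ => by
    obtain ⟨a, ha, h⟩ := hx s 0
    exact h ▸ ha
  have := countable_univ_iff.1 (hxA.countable_of_injOn hxi.injOn hc)
  obtain ⟨e, he⟩ := exists_injective_nat (ℕ → Bool)
  classical
  refine Function.cantor_injective (fun T : Set ℕ => e fun n => decide (n ∈ T)) fun T T' h => ?_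
  ext n
  simpa using congrFun (he h) n

/-- A nonempty countable set is smaller than the union of two disjoint copies of it. -/
theorem ltC_two_copies {A : ASet} (hA : A ≠ empty) (hc : A.elts.Countable) :
    (prod (nOrd 2) A).elts.Countable ∧ LtC A (prod (nOrd 2) A) := by
  have hcop : ∀ n < 2, ∀ B, (∀ x, x ∈ B ↔ ∃ a ∈ A, x = opair (nOrd n) a) →
      LeC A B ∧ B ⊆ prod (nOrd 2) A := fun n hn B hB =>
    ⟨leC_iff.2 ⟨opair (nOrd n), (continuous_opair.comp (Continuous.prodMk_right _)).continuousOn,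
      fun a _ b _ h => (opair_inj.1 h).2, fun a ha => (hB _).2 ⟨a, ha, rfl⟩⟩, fun x hx => by
      obtain ⟨a, ha, rfl⟩ := (hB x).1 hx
      exact opair_mem_prod.2 ⟨nOrd_mem_nOrd.2 hn, ha⟩⟩
  have hmem : ∀ n x, x ∈ prod (single (nOrd n)) A ↔ ∃ a ∈ A, x = opair (nOrd n) a := by
    intro n x
    simp [mem_prod]
  have hcount : (prod (nOrd 2) A).elts.Countable := by
    refine (((finite_nOrd 2).countable.prod hc).image fun p => opair p.1 p.2).mono ?_
    intro x hx
    obtain ⟨a, b, ha, hb, rfl⟩ := mem_prod.1 hx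
    exact ⟨(a, b), ⟨ha, hb⟩, rfl⟩
  refine ⟨hcount, ltC_iff.2 ⟨(hcop 0 (by omega) _ (hmem 0)).1.trans
    (.of_subset (hcop 0 (by omega) _ (hmem 0)).2), fun H => ?_⟩⟩
  -- If `2 × A` embedded in `A`, it would embed in each of its own two layers.
  refine not_countable_of_two_copies (A := prod (nOrd 2) A) ?_
    (H.trans (hcop 0 (by omega) _ (hmem 0)).1) (H.trans (hcop 1 (by omega) _ (hmem 1)).1)
    (hcop 0 (by omega) _ (hmem 0)).2 (hcop 1 (by omega) _ (hmem 1)).2 ?_ hcount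
  · obtain ⟨a, ha⟩ : ∃ a, a ∈ A := by
      by_contra! h
      exact hA (eq_empty_iff.2 h)
    exact fun h => eq_empty_iff.1 h (opair (nOrd 0) a)
      (opair_mem_prod.2 ⟨nOrd_mem_nOrd.2 (by omega), ha⟩)
  · intro x hx hx'
    obtain ⟨a, -, rfl⟩ := (hmem 0 x).1 hx
    obtain ⟨b, -, h⟩ := (hmem 1 _).1 hx'
    exact absurd (nOrd_injective (opair_inj.1 h).1) (by omega)

/-! ### Sums -/

theorem approx_prod {A B C D : ASet} {n : ℕ} (h : A.approx n = C.approx n)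
    (h' : B.approx n = D.approx n) : (prod A B).approx n = (prod C D).approx n := by
  have key : ∀ {A B C D : ASet} {n : ℕ}, A.approx (n + 1) = C.approx (n + 1) →
      B.approx (n + 1) = D.approx (n + 1) →
      ∀ x ∈ prod A B, ∃ y ∈ prod C D, y.approx n = x.approx n := by
    intro A B C D n h h' x hx
    obtain ⟨a, b, ha, hb, rfl⟩ := mem_prod.1 hx
    obtain ⟨c, hc, hca⟩ := (approx_succ_eq_iff.1 h).1 a ha
    obtain ⟨d, hd, hdb⟩ := (approx_succ_eq_iff.1 h').1 b hb
    exact ⟨opair c d, opair_mem_prod.2 ⟨hc, hd⟩, approx_opair hca hdb⟩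
  cases n with
  | zero => rfl
  | succ n => exact approx_succ_eq_iff.2 ⟨key h h', key h.symm h'.symm⟩

theorem continuous_prod_single : Continuous fun p : ASet × ASet => prod (single p.1) p.2 := by
  rw [continuous_iff_continuousAt]
  rintro ⟨a, b⟩
  rw [ContinuousAt, nhds_prod_eq,
    ((nhds_hasBasis a).prod (nhds_hasBasis b)).tendsto_iff (nhds_hasBasis _)]
  exact fun n _ => ⟨(n, n), ⟨trivial, trivial⟩, fun p hp =>
    approx_prod (approx_eq_of_le n.le_succ (approx_single hp.1)) hp.2⟩

/-- The map `(j, A) ↦ {j} × A` is continuous, so the layers form a closed family and both hulls in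
the definition are exact. -/
theorem mem_sum {I x : ASet} : x ∈ sum I ↔ ∃ j A a, opair j A ∈ I ∧ a ∈ A ∧ x = opair j a := by
  have hcl : IsClosed {x | ∃ j A, opair j A ∈ I ∧ x = prod (single j) A} := by
    have : {x | ∃ j A, opair j A ∈ I ∧ x = prod (single j) A} =
        (fun p : ASet × ASet => prod (single p.1) p.2) '' {p | opair p.1 p.2 ∈ I} := by
      ext x
      constructor
      · rintro ⟨j, A, h, rfl⟩
        exact ⟨(j, A), h, rfl⟩
      · rintro ⟨⟨j, A⟩, h, rfl⟩
        exact ⟨j, A, h, rfl⟩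
    rw [this]
    exact ((isClosed_opair_mem I).isCompact.image continuous_prod_single).isClosed
  rw [sum, mem_sUnion]
  constructor
  · rintro ⟨B, hB, hx⟩
    obtain ⟨j, A, h, rfl⟩ := (mem_hull hcl).1 hB
    obtain ⟨i, a, hi, ha, rfl⟩ := mem_prod.1 hx
    exact ⟨j, A, a, h, ha, by rw [mem_single.1 hi]⟩
  · rintro ⟨j, A, a, h, ha, rfl⟩
    exact ⟨_, (mem_hull hcl).2 ⟨j, A, h, rfl⟩, opair_mem_prod.2 ⟨mem_single.2 rfl, ha⟩⟩

theorem exists_elts_sum {I J : ASet} (h : IsIndexedSystem I J) :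
    ∃ φ : ASet → ASet, (∀ j ∈ J, opair j (φ j) ∈ I) ∧
      (sum I).elts = ⋃ j ∈ J.elts, opair j '' (φ j).elts := by
  obtain ⟨𝓕, hsub, htot, hfun⟩ := h
  choose! φ _ hφ using htot
  refine ⟨φ, hφ, ?_⟩
  ext x
  simp only [mem_elts, mem_sum, mem_iUnion, exists_prop]
  constructor
  · rintro ⟨j, A, a, hjA, ha, rfl⟩
    have hj := (opair_mem_prod.1 (hsub _ hjA)).1
    exact ⟨j, hj, a, hfun _ _ _ hjA (hφ j hj) ▸ ha, rfl⟩
  · rintro ⟨j, hj, a, ha, rfl⟩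
    exact ⟨j, φ j, a, hφ j hj, ha, rfl⟩

/-! ### Regular cardinals -/

theorem isRegular_of_not_countable {κ : ASet} (hκ : ¬ κ.elts.Countable) : IsRegular κ := by
  refine ⟨isCardinal_of_not_countable hκ, fun I J hI hJ hA => ltC_of_countable ?_ hκ⟩
  obtain ⟨φ, hφ, h⟩ := exists_elts_sum hI
  rw [h]
  exact hJ.countable.biUnion fun j hj => (hA j _ (hφ j hj)).2.countable.image _

theorem finite_of_ltC_of_eqC_omega {A κ : ASet} (hκ : EqC κ omega) (hA : LtC A κ) :
    A.elts.Finite := by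
  by_contra H
  exact (ltC_iff.1 hA).2 (hκ.1.trans (omega_leC H))

theorem isRegular_of_eqC_omega {κ : ASet} (hc : IsCardinal κ) (hκ : EqC κ omega) :
    IsRegular κ := by
  refine ⟨hc, fun I J hI hJ hA =>
    ltC_of_finite ?_ (infinite_of_isInfinite (isInfinite_of_eqC_omega hκ))⟩
  obtain ⟨φ, hφ, h⟩ := exists_elts_sum hI
  rw [h]
  exact (finite_of_ltC_of_eqC_omega hκ hJ).biUnion fun j hj =>
    (finite_of_ltC_of_eqC_omega hκ (hA j _ (hφ j hj)).2).image _

theorem isRegular_of_encard_le_two {κ : ASet} (hκ : κ.elts.encard ≤ 2) : IsRegular κ := by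
  have hfin : κ.elts.Finite := encard_lt_top_iff.1 (hκ.trans_lt (by decide))
  have hsub : ∀ {A : ASet}, LtC A κ → A.elts.encard ≤ 1 := fun {A} hA => by
    have := (hA.encard_lt hfin).trans_le hκ
    rwa [← one_add_one_eq_two, ENat.lt_add_one_iff (by decide)] at this
  refine ⟨isCardinal_of_finite hfin, fun I J hI hJ hA => ltC_of_encard_lt ?_⟩
  obtain ⟨φ, hφ, h⟩ := exists_elts_sum hI
  rw [h]
  rcases J.elts.eq_empty_or_nonempty with hJe | ⟨j, hj⟩
  -- With no index the sum is empty like `J`, and `J <_c κ` is itself the required inequality.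
  · simpa [hJe] using hJ.encard_lt hfin
  · have hJ' : J.elts = {j} :=
      (encard_le_one_iff_subsingleton.1 (hsub hJ)).eq_singleton_of_mem hj
    have hinj : InjOn (opair j) (φ j).elts := fun a _ b _ h => (opair_inj.1 h).2
    rw [hJ', biUnion_singleton, hinj.encard_image]
    exact (hA j _ (hφ j hj)).2.encard_lt hfin

/-! ### Singular cardinals -/

/-- A set that is, in a continuous way, a sum of fewer than `κ` parts each smaller than `κ` is not
regular. The parts are the classes of points with the same value of `D`. -/
theorem not_isRegular_of_partition {κ : ASet} {X : Type*} (D : ASet → X)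
    (hloc : ∀ x ∈ κ, (∃ N, ∀ y ∈ κ, y.approx N = x.approx N → D y = D x) ∨
      ∀ n, ∃ N, ∀ y ∈ κ, y.approx N = x.approx N → ∀ z ∈ κ, D z = D y → z.approx n = x.approx n)
    (hJ : ∀ J, J ⊆ κ → InjOn D J.elts → LtC J κ)
    (hpart : ∀ x ∈ κ, ∀ F, F ⊆ κ → (∀ y ∈ F, D y = D x) → ¬ LeC κ F) : ¬ IsRegular κ := by
  classical
  -- `r` selects a representative of each class. The retraction `π` onto representatives has the
  -- classes as fibres, and its image serves as index set. In `hloc`, either `D` is constant near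
  -- `x`, or the classes of nearby points shrink to `x`.
  obtain ⟨r, hr⟩ : ∃ r : X → ASet, ∀ x ∈ κ, r (D x) ∈ κ ∧ D (r (D x)) = D x := by
    refine ⟨fun d => if h : ∃ x ∈ κ, D x = d then h.choose else empty, fun x hx => ?_⟩
    have h : ∃ y ∈ κ, D y = D x := ⟨x, hx, rfl⟩
    simp only [h, dif_pos]
    exact h.choose_spec
  let π : ASet → ASet := fun x => r (D x)
  have hπκ : ∀ x ∈ κ, π x ∈ κ := fun x hx => (hr x hx).1
  have hDπ : ∀ x ∈ κ, D (π x) = D x := fun x hx => (hr x hx).2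
  have hππ : ∀ x ∈ κ, π (π x) = π x := fun x hx => congrArg r (hDπ x hx)
  have hsing : ∀ x, (∀ n, ∃ N, ∀ y ∈ κ, y.approx N = x.approx N → ∀ z ∈ κ, D z = D y →
      z.approx n = x.approx n) → x ∈ κ → ∀ z ∈ κ, D z = D x → z = x := by
    intro x h hx z hz hzx
    refine eq_of_forall_approx fun n => ?_
    obtain ⟨N, hN⟩ := h n
    exact hN x hx rfl z hz hzx
  have hπ : ContinuousOn π κ.elts := by
    refine continuousOn_iff_approx.2 fun x hx n => ?_
    rcases hloc x hx with ⟨N, hN⟩ | h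
    · exact ⟨N, fun y hy hyx => congrArg (fun d => (r d).approx n) (hN y hy hyx)⟩
    · obtain ⟨N, hN⟩ := h n
      refine ⟨N, fun y hy hyx => ?_⟩
      rw [hsing x h hx (π x) (hπκ x hx) (hDπ x hx)]
      exact hN y hy hyx (π y) (hπκ y hy) (hDπ y hy)
  have hfibcl : ∀ j, IsClosed (κ.elts ∩ π ⁻¹' {j}) := fun j =>
    hπ.preimage_isClosed_of_isClosed (isClosed_elts κ) isClosed_singleton
  let fib : ASet → ASet := fun j => ofClosed (κ.elts ∩ π ⁻¹' {j})
  have hfib : ∀ {j x}, x ∈ fib j ↔ x ∈ κ ∧ π x = j := fun {j x} => mem_ofClosed (hfibcl j)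
  -- A class need not be a cardinal, so it is replaced by a cardinal inside it into which it embeds.
  choose S hSsub hScard hSle using fun j => exists_isCardinal_subset (fib j)
  choose f hf hfi hfm using fun j => leC_iff.1 (hSle j)
  have hJcl : IsClosed (π '' κ.elts) :=
    ((isClosed_elts κ).isCompact.image_of_continuousOn hπ).isClosed
  let J := ofClosed (π '' κ.elts)
  have hJmem : ∀ {j}, j ∈ J ↔ ∃ x ∈ κ, π x = j := fun {j} => mem_ofClosed hJcl
  have hJκ : J ⊆ κ := fun j hj => by
    obtain ⟨x, hx, rfl⟩ := hJmem.1 hj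
    exact hπκ x hx
  have hJπ : ∀ j ∈ J, π j = j := fun j hj => by
    obtain ⟨x, hx, rfl⟩ := hJmem.1 hj
    exact hππ x hx
  have hfS : ∀ x ∈ κ, f (π x) x ∈ S (π x) := fun x hx => hfm (π x) (hfib.2 ⟨hx, rfl⟩)
  have hSmem : ∀ {j x}, j ∈ J → x ∈ S j → x ∈ κ ∧ D x = D j := fun {j x} hj hx => by
    obtain ⟨hxκ, hxj⟩ := hfib.1 (hSsub j x hx)
    exact ⟨hxκ, by rw [← hDπ x hxκ, hxj]⟩
  -- Continuity makes the system a set. Near an index of the first kind there is no other index; at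
  -- one of the second kind `S j = {j}`, and nearby summands lie in a small ball around `j`.
  have hS : ContinuousOn S J.elts := by
    refine continuousOn_iff_approx.2 fun j hj n => ?_
    rcases hloc j (hJκ j hj) with ⟨N, hN⟩ | h
    · refine ⟨N, fun y hy hyj => ?_⟩
      have : y = j := by
        rw [← hJπ y hy, ← hJπ j hj]
        exact congrArg r (hN y (hJκ y hy) hyj)
      rw [this]
    · cases n with
      | zero => exact ⟨0, fun _ _ _ => rfl⟩
      | succ n =>
        obtain ⟨N, hN⟩ := h n
        refine ⟨N, fun y hy hyj => ?_⟩
        have h1 : ∀ x ∈ S j, x = j := fun x hx =>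
          hsing j h (hJκ j hj) x (hSmem hj hx).1 (hSmem hj hx).2
        have h2 : ∀ x ∈ S y, x.approx n = j.approx n := fun x hx =>
          hN y (hJκ y hy) hyj x (hSmem hy hx).1 (hSmem hy hx).2
        have hne : ∀ i ∈ J, ∃ x, x ∈ S i := fun i hi => by
          obtain ⟨x, hx, rfl⟩ := hJmem.1 hi
          exact ⟨_, hfS x hx⟩
        refine approx_succ_eq_iff.2 ⟨fun x hx => ?_, fun x hx => ?_⟩
        · obtain ⟨z, hz⟩ := hne j hj
          exact ⟨z, hz, by rw [h1 z hz, h2 x hx]⟩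
        · obtain ⟨z, hz⟩ := hne y hy
          exact ⟨z, hz, by rw [h1 x hx, h2 z hz]⟩
  have hFcl : IsClosed (S '' J.elts) :=
    ((isClosed_elts J).isCompact.image_of_continuousOn hS).isClosed
  rintro ⟨-, hreg⟩
  refine (ltC_iff.1 (hreg (graph S J) J ⟨ofClosed (S '' J.elts), isFunction_graph hS ?_⟩ ?_ ?_)).2 ?_
  · rw [elts_ofClosed hFcl]
    exact mapsTo_image S J.elts
  · refine hJ J hJκ fun x hx y hy hxy => ?_
    rw [← hJπ x hx, ← hJπ y hy]
    exact congrArg r hxy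
  · intro j A hjA
    obtain ⟨hj, rfl⟩ := (opair_mem_graph hS).1 hjA
    refine ⟨hScard j, ltC_iff.2 ⟨.of_subset fun x hx => (hSmem hj hx).1, ?_⟩⟩
    exact hpart j (hJκ j hj) (S j) (fun x hx => (hSmem hj hx).1) fun x hx => (hSmem hj hx).2
  -- Each point goes to its class index paired with its image in the summand, so `κ` embeds in the
  -- sum, contradicting regularity.
  · refine leC_iff.2 ⟨fun x => opair (π x) (f (π x) x), ?_, ?_, ?_⟩
    · refine continuousOn_iff_approx.2 fun x hx n => ?_
      obtain ⟨M, hM⟩ := continuousOn_iff_approx.1 hπ x hx n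
      rcases hloc x hx with ⟨N, hN⟩ | h
      · obtain ⟨L, hL⟩ := continuousOn_iff_approx.1 (hf (π x)) x (hfib.2 ⟨hx, rfl⟩) n
        refine ⟨max N L, fun y hy hyx => ?_⟩
        have hπy : π y = π x := congrArg r (hN y hy (approx_eq_of_le (le_max_left _ _) hyx))
        simp only [hπy]
        exact approx_opair rfl
          (hL y (hfib.2 ⟨hy, hπy⟩) (approx_eq_of_le (le_max_right _ _) hyx))
      · obtain ⟨N, hN⟩ := h n
        refine ⟨max M N, fun y hy hyx => approx_opair
          (hM y hy (approx_eq_of_le (le_max_left _ _) hyx)) ?_⟩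
        have hyN := approx_eq_of_le (le_max_right _ _) hyx
        have hfD : ∀ z ∈ κ, f (π z) z ∈ κ ∧ D (f (π z) z) = D z := fun z hz => by
          obtain ⟨h1, h2⟩ := hSmem (hJmem.2 ⟨z, hz, rfl⟩) (hfS z hz)
          exact ⟨h1, h2.trans (hDπ z hz)⟩
        rw [hN y hy hyN _ (hfD y hy).1 (hfD y hy).2, hsing x h hx _ (hfD x hx).1 (hfD x hx).2]
    · intro x hx y hy hxy
      obtain ⟨h1, h2⟩ := opair_inj.1 hxy
      rw [h1] at h2
      exact hfi (π y) (hfib.2 ⟨hx, h1⟩) (hfib.2 ⟨hy, rfl⟩) h2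
    · intro x hx
      exact mem_sum.2 ⟨π x, S (π x), _, (opair_mem_graph hS).2 ⟨hJmem.2 ⟨x, hx, rfl⟩, rfl⟩,
        hfS x hx, rfl⟩

theorem not_isRegular_of_finite {κ : ASet} (hfin : κ.elts.Finite) (hκ : 2 < κ.elts.encard) :
    ¬ IsRegular κ := by
  obtain ⟨a, b, ha, hb, hab⟩ := one_lt_encard_iff.1 (lt_trans (by decide) hκ)
  have hsub : ∀ F, F ⊆ κ → ∀ c ∈ κ, c ∉ F → ¬ LeC κ F := by
    intro F hF c hc hcF h
    refine hcF ?_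
    have : F.elts = κ.elts :=
      (hfin.subset (subset_iff_elts.1 hF)).eq_of_subset_of_encard_le hF h.encard_le
    exact (this ▸ hc : c ∈ F.elts)
  refine not_isRegular_of_partition (· = a) (fun x hx => .inl ?_) ?_ ?_
  · obtain ⟨N, hN⟩ := exists_approx_ne_of_finite (S := κ.elts \ {x}) hfin.sdiff
      (p := x) fun h => h.2 rfl
    refine ⟨N, fun y hy hyx => ?_⟩
    by_cases h : y = x
    · rw [h]
    · exact absurd hyx (hN y ⟨hy, h⟩)
  · intro J _ hJ
    refine ltC_of_encard_lt (lt_of_le_of_lt ?_ hκ)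
    -- `D` takes values in `Prop`, so there are at most two classes.
    refine (encard_le_encard_of_injOn (mapsTo_univ _ _) hJ).trans ?_
    simp [encard_univ]
  · intro x hx F hF hD
    by_cases hxa : x = a
    · refine hsub F hF b hb fun h => hab ?_
      exact (of_eq_true ((hD b h).trans (eq_true hxa))).symm
    · refine hsub F hF a ha fun h => hxa ?_
      exact of_eq_true ((hD a h).symm.trans (eq_true rfl))

theorem localPart_subset {A x : ASet} {n : ℕ} : localPart A n x ⊆ A :=
  fun _ hy => (mem_localPart.1 hy).1

/-- Either the neighborhoods of some size are all smaller than `κ`, or `κ` can be found in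
arbitrarily small neighborhoods of one of its elements. -/
theorem localPart_dichotomy (κ : ASet) : (∃ N, ∀ x ∈ κ, ¬ LeC κ (localPart κ N x)) ∨
    ∃ p ∈ κ, ∀ N, LeC κ (localPart κ N p) := by
  by_contra! H
  obtain ⟨H, hno⟩ := H
  -- Whether `κ` embeds in the part around `x` depends only on the `N`th approximation of `x`.
  -- Compactness then yields one point good for all `N`.
  have hcl : ∀ N, IsClosed {x | x ∈ κ ∧ LeC κ (localPart κ N x)} := by
    intro N
    refine isClosed_iff_approx.2 fun x hx => ⟨isClosed_iff_approx.1 (isClosed_elts κ) x fun n => ?_,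
      ?_⟩
    · obtain ⟨y, hy, hyx⟩ := hx n
      exact ⟨y, hy.1, hyx⟩
    · obtain ⟨y, hy, hyx⟩ := hx N
      exact hy.2.trans (.of_subset fun z hz => mem_localPart.2
        ⟨(mem_localPart.1 hz).1, (mem_localPart.1 hz).2.trans hyx⟩)
  have hanti : ∀ N, {x | x ∈ κ ∧ LeC κ (localPart κ (N + 1) x)} ⊆
      {x | x ∈ κ ∧ LeC κ (localPart κ N x)} := fun N x hx =>
    ⟨hx.1, hx.2.trans (.of_subset fun z hz => mem_localPart.2
      ⟨(mem_localPart.1 hz).1, approx_eq_of_le N.le_succ (mem_localPart.1 hz).2⟩)⟩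
  obtain ⟨p, hp⟩ := IsCompact.nonempty_iInter_of_sequence_nonempty_isCompact_isClosed
    (fun N => {x | x ∈ κ ∧ LeC κ (localPart κ N x)}) hanti (fun N => H N) (hcl 0).isCompact hcl
  rw [mem_iInter] at hp
  obtain ⟨N, hN⟩ := hno p (hp 0).1
  exact hN (hp N).2

/-- If all parts at some level are smaller than `κ`, the finitely many nodes of that level give the
partition. Otherwise `κ` recurs in every neighborhood of some `p`, and the classes are `{p}` and the
shells of points that part from `p` at the same level. -/
theorem not_isRegular_of_countable {κ : ASet} (hc : κ.elts.Countable) (hinf : κ.elts.Infinite)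
    (hκ : ¬ EqC κ omega) : ¬ IsRegular κ := by
  have hle : ¬ LeC κ omega := fun h => hκ ⟨h, omega_leC hinf⟩
  rcases localPart_dichotomy κ with ⟨N, hN⟩ | ⟨p, hp, hpκ⟩
  · refine not_isRegular_of_partition (fun x => x.approx N) (fun x _ => .inl ⟨N, fun _ _ h => h⟩)
      (fun J _ hJ => ltC_of_finite ?_ hinf) fun x hx F hF hD h => hN x hx (h.trans
        (.of_subset fun y hy => mem_localPart.2 ⟨hF y hy, hD y hy⟩))
    exact Finite.of_finite_image (toFinite _) hJ
  let D : ASet → Set ℕ := fun x => {n | x.approx n = p.approx n}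
  have hD : ∀ x, x ≠ p → ∃ N, N ∉ D x ∧ ∀ y, y.approx N = x.approx N → D y = D x := by
    intro x hx
    obtain ⟨N, hN⟩ := exists_approx_ne hx
    refine ⟨N, hN, fun y hy => Set.ext fun n => ?_⟩
    change y.approx n = p.approx n ↔ x.approx n = p.approx n
    rcases le_total n N with h | h
    · rw [approx_eq_of_le h hy]
    · exact iff_of_false (fun h' => hN (hy.symm.trans (approx_eq_of_le h h')))
        fun h' => hN (approx_eq_of_le h h')
  refine not_isRegular_of_partition D (fun x _ => ?_) (fun J hJκ hJ => ltC_iff.2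
    ⟨.of_subset hJκ, fun hκJ => hle ?_⟩) fun x hx F hF hFD hκF => ?_
  · by_cases hxp : x = p
    · subst hxp
      refine .inr fun n => ⟨n, fun y _ hy z _ hz => ?_⟩
      exact (hz ▸ (show n ∈ D y from hy) : n ∈ D z)
    · obtain ⟨N, -, hN⟩ := hD x hxp
      exact .inl ⟨N, fun y _ => hN y⟩
  -- With one index per shell, `p` is the only possible limit of the index set, so it embeds in `ω`;
  -- but `κ` does not.
  · have hmem : ∀ {x}, x ∈ union J (single p) ↔ x ∈ J ∨ x = p := by simp
    have hK : IsOneLimit (union J (single p)) p := by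
      refine ⟨hmem.2 (.inr rfl), fun x hx hxp => ?_⟩
      obtain ⟨N, hN, hN'⟩ := hD x hxp
      refine ⟨N, fun y hy hyx => ?_⟩
      rcases hmem.1 hy with hyJ | rfl
      · exact hJ hyJ ((hmem.1 hx).resolve_right hxp) (hN' y hyx)
      · exact absurd hyx.symm hN
    refine hκJ.trans ((LeC.of_subset fun x hx => hmem.2 (.inl hx)).trans
      (hK.leC (hc.mono fun x hx => ?_) infinite_omega))
    rcases hmem.1 hx with h | rfl
    · exact hJκ x h
    · exact hp
  · by_cases hxp : x = p
    · subst hxp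
      refine hinf (hκF.finite ((finite_singleton x).subset fun y hy => ?_))
      refine eq_of_forall_approx fun n => ?_
      exact (hFD y hy ▸ (show n ∈ D x from rfl) : n ∈ D y)
    -- The shell of `x` avoids the ball of level `N` around `p`, which also contains a copy of `κ`:
    -- two disjoint copies in a countable set.
    · obtain ⟨N, hN, -⟩ := hD x hxp
      refine not_countable_of_two_copies (A := κ) (fun h => eq_empty_iff.1 h p hp) hκF (hpκ N) hF
        localPart_subset (fun y hy hy' => hN ?_) hc
      exact (hFD y hy ▸ (show N ∈ D y from (mem_localPart.1 hy').2) : N ∈ D x)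

/-! ### Classification of the cardinals -/

theorem isRegular_iff {κ : ASet} (hκ : IsCardinal κ) : IsRegular κ ↔
    EqC κ (nOrd 0) ∨ EqC κ (nOrd 1) ∨ EqC κ (nOrd 2) ∨ EqC κ omega ∨ EqC κ (powerset omega) := by
  simp only [eqC_iff_encard (finite_nOrd _), encard_nOrd, eqC_powerset_omega_iff]
  constructor
  · intro h
    by_cases hfin : κ.elts.Finite
    · have h2 : κ.elts.encard ≤ 2 := not_lt.1 fun h2 => not_isRegular_of_finite hfin h2 h
      obtain ⟨n, hn⟩ := ENat.ne_top_iff_exists.1 hfin.encard_lt_top.ne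
      rw [← hn] at h2 ⊢
      have : n ≤ 2 := by exact_mod_cast h2
      interval_cases n <;> simp
    · by_cases hc : κ.elts.Countable
      · by_cases hω : EqC κ omega
        · exact .inr (.inr (.inr (.inl hω)))
        · exact absurd h (not_isRegular_of_countable hc hfin hω)
      · exact .inr (.inr (.inr (.inr hc)))
  · rintro (h | h | h | h | h)
    · exact isRegular_of_encard_le_two (by rw [h]; decide)
    · exact isRegular_of_encard_le_two (by rw [h]; decide)
    · exact isRegular_of_encard_le_two (by rw [h]; decide)
    · exact isRegular_of_eqC_omega hκ h
    · exact isRegular_of_not_countable h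

theorem isStrongLimit_iff {κ : ASet} (hκ : IsCardinal κ) : IsStrongLimit κ ↔ EqC κ omega := by
  constructor
  · rintro ⟨-, hinf, h⟩
    by_contra hω
    have hlt : LtC omega κ := ⟨omega_leC (infinite_of_isInfinite hinf), fun h => hω ⟨h.2, h.1⟩⟩
    exact (ltC_iff.1 (h omega isCardinal_omega hlt)).2
      (leC_of_not_countable not_countable_powerset_omega κ)
  · intro h
    have hinf := isInfinite_of_eqC_omega h
    exact ⟨hκ, hinf, fun κ' _ hlt => ltC_of_finite
      (finite_powerset (finite_of_ltC_of_eqC_omega h hlt)) (infinite_of_isInfinite hinf)⟩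

theorem isCountable_of_eqC_omega {A : ASet} (h : EqC A omega) : IsCountable A :=
  .inr (inBijection_omega h.1 (infinite_of_isInfinite (isInfinite_of_eqC_omega h)))

theorem isCountable_of_finite {A : ASet} (h : A.elts.Finite) : IsCountable A :=
  .inl fun H => infinite_of_isInfinite H h

theorem not_isCountable {A : ASet} (h : ¬ A.elts.Countable) : ¬ IsCountable A := by
  rintro (H | ⟨f, hf, -⟩)
  · exact H (isInfinite_of_not_countable h)
  · exact h (LeC.countable ⟨f, hf⟩ countable_omega)

theorem isLimit_of_not_countable {κ : ASet} (h : ¬ κ.elts.Countable) : IsLimit κ := by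
  refine ⟨isCardinal_of_not_countable h, ?_, ?_⟩
  · rintro rfl
    exact h (by simp)
  · rintro ⟨A, -, -, hA, hno⟩
    refine hno ?_
    -- Doubling does not enlarge the empty set, so there `1` serves as the intermediate cardinal.
    by_cases hAe : A = empty
    · subst hAe
      exact ⟨nOrd 1, isCardinal_of_finite (finite_nOrd 1),
        ltC_of_encard_lt (by rw [encard_nOrd]; simp), ltC_of_countable (finite_nOrd 1).countable h⟩
    · obtain ⟨hc, hlt⟩ := ltC_two_copies hAe hA.countable
      obtain ⟨S, hS, hScard, hle⟩ := exists_isCardinal_subset (prod (nOrd 2) A)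
      exact ⟨S, hScard, hlt.of_leC hle, ltC_of_countable (hc.mono hS) h⟩

theorem isInaccessible_iff {κ : ASet} (hκ : IsCardinal κ) :
    IsInaccessible κ ↔ EqC κ (powerset omega) := by
  constructor
  · rintro ⟨hreg, -, hc⟩
    rcases (isRegular_iff hκ).1 hreg with h | h | h | h | h
    · exact absurd (isCountable_of_finite (h.1.finite (finite_nOrd _))) hc
    · exact absurd (isCountable_of_finite (h.1.finite (finite_nOrd _))) hc
    · exact absurd (isCountable_of_finite (h.1.finite (finite_nOrd _))) hc
    · exact absurd (isCountable_of_eqC_omega h) hc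
    · exact h
  · intro h
    rw [eqC_powerset_omega_iff] at h
    exact ⟨isRegular_of_not_countable h, isLimit_of_not_countable h, not_isCountable h⟩

end AS

theorem theorem11p16 :
    -- the sets named in the result are cardinals
    (AS.IsCardinal (AS.nOrd 0) ∧ AS.IsCardinal (AS.nOrd 1) ∧ AS.IsCardinal (AS.nOrd 2) ∧
      AS.IsCardinal AS.omega ∧ AS.IsCardinal (AS.powerset AS.omega)) ∧
    -- regular and singular cardinals
    (∀ κ : AS.ASet, AS.IsCardinal κ →
      (AS.IsRegular κ ↔
        AS.EqC κ (AS.nOrd 0) ∨ AS.EqC κ (AS.nOrd 1) ∨ AS.EqC κ (AS.nOrd 2) ∨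
          AS.EqC κ AS.omega ∨ AS.EqC κ (AS.powerset AS.omega))) ∧
    (∀ κ : AS.ASet, AS.IsCardinal κ →
      (AS.IsSingular κ ↔
        ¬ (AS.EqC κ (AS.nOrd 0) ∨ AS.EqC κ (AS.nOrd 1) ∨ AS.EqC κ (AS.nOrd 2) ∨
          AS.EqC κ AS.omega ∨ AS.EqC κ (AS.powerset AS.omega)))) ∧
    -- strong limit cardinals
    (∀ κ : AS.ASet, AS.IsCardinal κ → (AS.IsStrongLimit κ ↔ AS.EqC κ AS.omega)) ∧
    -- inaccessible cardinals
    (∀ κ : AS.ASet, AS.IsCardinal κ →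
      (AS.IsInaccessible κ ↔ AS.EqC κ (AS.powerset AS.omega))) ∧
    -- strongly inaccessible cardinals do not exist
    (¬ ∃ κ : AS.ASet, AS.IsStronglyInaccessible κ) := by
  refine ⟨⟨AS.isCardinal_of_finite (AS.finite_nOrd 0), AS.isCardinal_of_finite (AS.finite_nOrd 1),
      AS.isCardinal_of_finite (AS.finite_nOrd 2), AS.isCardinal_omega,
      AS.isCardinal_of_not_countable AS.not_countable_powerset_omega⟩,
    fun κ hκ => AS.isRegular_iff hκ, fun κ hκ => ?_, fun κ hκ => AS.isStrongLimit_iff hκ,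
    fun κ hκ => AS.isInaccessible_iff hκ, ?_⟩
  · rw [← AS.isRegular_iff hκ]
    exact and_iff_right hκ
  · rintro ⟨κ, hlim, -, hc⟩
    exact hc (AS.isCountable_of_eqC_omega ((AS.isStrongLimit_iff hlim.1).1 hlim))
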